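/- Let $X$ be a topological space and let $A$ be a complete noetherian commutative local ring with maximal ideal $\mathfrak m$. For $i\ge 0$ write $A_i := A/\mathfrak m^{i+1}$. Definitions. All sheaves are on $X$, and the cohomology is sheaf cohomology. * For an $A$-module $N$ and a sheaf of $A$-modules $\mathcal M$, the sheaf $N\otimes_A\mathcal M$ is the sheaf associated to the presheaf $U\mapsto N\otimes_A\Gamma(U,\mathcal M)$ (and similarly over $A_i$). The sheaf $\mathcal M$ is *flat* over $A$ if every stalk $\mathcal M_x$ is a flat $A$-module (and similarly for sheaves of $A_i$-modules). It is *$\mathfrak m$-adically complete* if the canonical homomorphism $\mathcal M\to\varprojlim_i (A_i\otimes_A\mathcal M)$ is an isomorphism. * An *$\mathfrak m$-adic system of sheaves of $A$-modules* on $X$ is a collection $\{\mathcal M_i\}_{i\in\mathbb N}$ of sheaves of $A$-modules with $A$-linear homomorphisms $\psi_i:\mathcal M_{i+1}\to\mathcal M_i$ such that, for every $i$, $\mathfrak m^{i+1}\mathcal M_i=0$ (so that $\mathcal M_i$ is a sheaf of $A_i$-modules), and the homomorphism $A_i\otimes_{A_{i+1}}\mathcal M_{i+1}\to\mathcal M_i$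 induced by $\psi_i$ is an isomorphism. * For a sheaf of abelian groups $\mathcal N$ on $X$, an open set $U\subseteq X$ is *$\mathcal N$-simply connected* if $\mathrm H^1(U,\mathcal N)=0$. The space $X$ is *locally $\mathcal N$-simply connected* if the $\mathcal N$-simply connected open sets form a basis of the topology of $X$. * An $A$-module is *$\mathfrak m$-adically free* if it is isomorphic, for some set $Z$, to the $A$-module of decaying functions $f:Z\to\widehat A$, where $\widehat A=\varprojlim_i A_i$ (which is $A$ here). A function $f$ is *decaying* if for every $i\in\mathbb N$ the set $\{z\in Z: f(z)\notin\mathfrak m^{i+1}\widehat A\}$ is finite. Let $\{\mathcal M_i\}_{i\in\mathbb N}$ be an $\mathfrak m$-adic system of sheaves of $A$-modules on $X$, and assume: (i) for every $i\ge 0$ the sheaf of $A_i$-modules $\mathcal M_i$ is flat over $A_i$; (ii) $X$ is locally $\mathcal M_0$-simply connected. Let $\mathcal M:=\varprojlim_i\mathcal M_i$, a sheaf of $A$-modules on $X$. Then: 1. $\mathcal M$ is flat over $A$ and $\mathfrak m$-adically complete. 2. For every $i\ge 0$ the canonical homomorphism of sheaves $A_i\otimes_A\mathcal M\to\mathcal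 M_i$ is an isomorphism. 3. For every open set $U\subseteq X$ that is $\mathcal M_0$-simply connected, the $A$-module $\Gamma(U,\mathcal M)$ is $\mathfrak m$-adically free. -/

import Mathlib

open CategoryTheory Limits TopologicalSpace Opposite
open scoped TensorProduct

universe u

namespace AdicSheaf

noncomputable section

/-! ### Decaying functions and adically free modules -/

/-- The submodule `F_dec(Z, M)` of decaying functions `f : Z → M`: for every `i` only finitely many
`z` satisfy `ord_I (f z) ≤ i`, i.e. `f z ∉ I ^ (i + 1) M`. -/
def decaying {A : Type u} [CommRing A] (I : Ideal A) (Z : Type u)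
    (M : Type u) [AddCommGroup M] [Module A M] : Submodule A (Z → M) where
  carrier := {f | ∀ i : ℕ, {z | f z ∉ (I ^ (i + 1) • ⊤ : Submodule A M)}.Finite}
  zero_mem' := fun i => by simp
  add_mem' := fun {f g} hf hg i => ((hf i).union (hg i)).subset fun z hz => by
    by_contra h
    simp only [Set.mem_union, Set.mem_ofPred_eq, not_or, not_not] at h
    exact hz (Submodule.add_mem _ h.1 h.2)
  smul_mem' := fun c f hf i => (hf i).subset fun _ hz h => hz (Submodule.smul_mem _ c h)

/-- `P` is `I`-adically free: `P ≅ F_dec(Z, Â)` for some set `Z`, where `Â` is the `I`-adic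
completion of `A`. -/
def IsAdicallyFree {A : Type u} [CommRing A] (I : Ideal A)
    (P : Type u) [AddCommGroup P] [Module A P] : Prop :=
  ∃ Z : Type u, Nonempty (P ≃ₗ[A] decaying I Z (AdicCompletion I A))

/-! ### Tensor products of a module with a sheaf of modules -/

variable {A : Type u} [CommRing A] {X : TopCat.{u}}

/-- The presheaf `U ↦ N ⊗_A Γ(U, M)`. -/
def tensorPresheaf (N : Type u) [AddCommGroup N] [Module A N]
    (M : TopCat.Presheaf (ModuleCat.{u} A) X) : TopCat.Presheaf (ModuleCat.{u} A) X where
  obj U := ModuleCat.of A (N ⊗[A] M.obj U)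
  map f := ModuleCat.ofHom ((M.map f).hom.lTensor N)
  map_id U := by
    ext : 1
    simp
  map_comp f g := by
    ext : 1
    simp [LinearMap.lTensor_comp]

/-- The sheaf associated to a presheaf of `A`-modules. -/
abbrev sheafAssociated (P : TopCat.Presheaf (ModuleCat.{u} A) X) :
    TopCat.Sheaf (ModuleCat.{u} A) X :=
  (presheafToSheaf (Opens.grothendieckTopology X) (ModuleCat.{u} A)).obj P

/-- The sheaf `N ⊗_A M`, associated to the presheaf `U ↦ N ⊗_A Γ(U, M)`. -/
def tensorSheaf (N : Type u) [AddCommGroup N] [Module A N]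
    (M : TopCat.Sheaf (ModuleCat.{u} A) X) : TopCat.Sheaf (ModuleCat.{u} A) X :=
  sheafAssociated (tensorPresheaf N M.presheaf)

/-- Functoriality of `N ⊗_A M` in the module `N`. -/
def tensorSheafMap {N N' : Type u} [AddCommGroup N] [Module A N] [AddCommGroup N'] [Module A N']
    (φ : N →ₗ[A] N') (M : TopCat.Sheaf (ModuleCat.{u} A) X) :
    tensorSheaf N M ⟶ tensorSheaf N' M :=
  (presheafToSheaf (Opens.grothendieckTopology X) (ModuleCat.{u} A)).map
    { app := fun U => ModuleCat.ofHom (φ.rTensor (M.presheaf.obj U))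
      naturality := fun U V f => by
        ext : 1
        exact TensorProduct.ext' fun n s => rfl }

/-- The ring `A_i = A / I ^ (i + 1)`. -/
abbrev QuotPow (I : Ideal A) (i : ℕ) : Type u := A ⧸ I ^ (i + 1)

/-- The projection `A_{i+1} → A_i`. -/
def quotMap (I : Ideal A) (i : ℕ) : QuotPow I (i + 1) →ₗ[A] QuotPow I i :=
  (Ideal.Quotient.factorₐ A (Ideal.pow_le_pow_right (Nat.le_succ (i + 1)))).toLinearMap

/-- The presheaf homomorphism underlying `toTensor`. -/
def toTensorPresheaf (I : Ideal A) (i : ℕ) (M : TopCat.Presheaf (ModuleCat.{u} A) X) :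
    M ⟶ tensorPresheaf (QuotPow I i) M where
  app U := ModuleCat.ofHom (TensorProduct.mk A (QuotPow I i) (M.obj U) 1)
  naturality U V f := by
    ext s
    rfl

/-- The canonical homomorphism `M → A_i ⊗_A M`, `s ↦ 1 ⊗ s`. -/
def toTensor (I : Ideal A) (i : ℕ) (M : TopCat.Sheaf (ModuleCat.{u} A) X) :
    M ⟶ tensorSheaf (QuotPow I i) M :=
  ⟨toTensorPresheaf I i M.presheaf ≫
    toSheafify (Opens.grothendieckTopology X) (tensorPresheaf (QuotPow I i) M.presheaf)⟩

/-! ### Sheaves of modules over a quotient ring -/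

/-- The sheaf `M` satisfies `I M = 0`. -/
def IsKilledBy (I : Ideal A) (M : TopCat.Sheaf (ModuleCat.{u} A) X) : Prop :=
  ∀ (U : Opens X) (r : A) (s : M.presheaf.obj (op U)), r ∈ I → r • s = 0

lemma IsKilledBy.isTorsionBySet {I : Ideal A} {M : TopCat.Sheaf (ModuleCat.{u} A) X}
    (h : IsKilledBy I M) (U : (Opens X)ᵒᵖ) :
    Module.IsTorsionBySet A (M.presheaf.obj U) I :=
  fun s r => h U.unop r s r.2

lemma IsKilledBy.isTorsionBySet_stalk {I : Ideal A} {M : TopCat.Sheaf (ModuleCat.{u} A) X}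
    (h : IsKilledBy I M) (x : X) :
    Module.IsTorsionBySet A (M.presheaf.stalk x) I := by
  intro t r
  obtain ⟨U, hx, s, rfl⟩ := M.presheaf.exists_germ_eq t
  have := h U r s r.2
  rw [← map_smul, this, map_zero]

/-- For `φ : N → L` and `I L = 0`, the induced homomorphism `(A / I) ⊗_A N → L`,
`a ⊗ n ↦ a • φ n`. -/
def inducedLinearMap {I : Ideal A} {N L : Type u} [AddCommGroup N] [Module A N]
    [AddCommGroup L] [Module A L] (hL : Module.IsTorsionBySet A L I) (φ : N →ₗ[A] L) :
    (A ⧸ I) ⊗[A] N →ₗ[A] L :=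
  letI : Module (A ⧸ I) L := hL.module
  haveI : IsScalarTower A (A ⧸ I) L := hL.isScalarTower
  (φ.liftBaseChange (A ⧸ I)).restrictScalars A

lemma inducedLinearMap_tmul {I : Ideal A} {N L : Type u} [AddCommGroup N] [Module A N]
    [AddCommGroup L] [Module A L] (hL : Module.IsTorsionBySet A L I) (φ : N →ₗ[A] L)
    (a : A) (n : N) :
    inducedLinearMap hL φ (Ideal.Quotient.mk I a ⊗ₜ[A] n) = a • φ n := by
  let : Module (A ⧸ I) L := hL.module
  have : IsScalarTower A (A ⧸ I) L := hL.isScalarTower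
  exact LinearMap.liftBaseChange_tmul (A ⧸ I) φ (Ideal.Quotient.mk I a) n

/-- For `φ : M → L` with `I L = 0`, the homomorphism from the presheaf `U ↦ (A / I) ⊗_A Γ(U, M)`
to `L`. -/
def inducedPresheafHom {I : Ideal A} {M L : TopCat.Sheaf (ModuleCat.{u} A) X}
    (hL : IsKilledBy I L) (φ : M ⟶ L) : tensorPresheaf (A ⧸ I) M.presheaf ⟶ L.presheaf where
  app U := ModuleCat.ofHom (inducedLinearMap (hL.isTorsionBySet U) (φ.hom.app U).hom)
  naturality U V f := by
    ext : 1
    refine TensorProduct.ext' fun a s => ?_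
    obtain ⟨a, rfl⟩ := Ideal.Quotient.mk_surjective a
    have h := ConcreteCategory.congr_hom (φ.hom.naturality f) s
    change inducedLinearMap _ _ (Ideal.Quotient.mk I a ⊗ₜ[A] (M.presheaf.map f s)) =
      (L.presheaf.map f).hom (inducedLinearMap _ _ (Ideal.Quotient.mk I a ⊗ₜ[A] s))
    rw [inducedLinearMap_tmul, inducedLinearMap_tmul, map_smul]
    exact congrArg (a • ·) h

/-- For `φ : M → L` with `I L = 0`, the induced sheaf homomorphism `(A / I) ⊗_A M → L`. -/
def inducedHom {I : Ideal A} {M L : TopCat.Sheaf (ModuleCat.{u} A) X}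
    (hL : IsKilledBy I L) (φ : M ⟶ L) : tensorSheaf (A ⧸ I) M ⟶ L :=
  ⟨sheafifyLift (Opens.grothendieckTopology X) (inducedPresheafHom hL φ) L.property⟩

/-! ### Flatness, completeness, and simple connectedness -/

/-- The sheaf of `A`-modules `M` is flat over `A`: all its stalks are flat. -/
def IsFlat (M : TopCat.Sheaf (ModuleCat.{u} A) X) : Prop :=
  ∀ x : X, Module.Flat A (M.presheaf.stalk x)

/-- If `I M = 0`, so that `M` is a sheaf of `A / I`-modules: `M` is flat over `A / I`. -/
def IsFlatOverQuotient {I : Ideal A} {M : TopCat.Sheaf (ModuleCat.{u} A) X}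
    (h : IsKilledBy I M) : Prop :=
  ∀ x : X,
    letI : Module (A ⧸ I) (M.presheaf.stalk x) := (h.isTorsionBySet_stalk x).module
    Module.Flat (A ⧸ I) (M.presheaf.stalk x)

/-- The inverse system `i ↦ A_i ⊗_A M`. -/
def completionSystem (I : Ideal A) (M : TopCat.Sheaf (ModuleCat.{u} A) X) :
    ℕᵒᵖ ⥤ TopCat.Sheaf (ModuleCat.{u} A) X :=
  Functor.ofOpSequence (X := fun i => tensorSheaf (QuotPow I i) M)
    fun i => tensorSheafMap (quotMap I i) M

lemma toTensor_comp (I : Ideal A) (M : TopCat.Sheaf (ModuleCat.{u} A) X) (i : ℕ) :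
    toTensor I (i + 1) M ≫ tensorSheafMap (quotMap I i) M = toTensor I i M := by
  apply Sheaf.hom_ext
  refine (Category.assoc _ _ _).trans ?_
  refine (congrArg (toTensorPresheaf I (i + 1) M.presheaf ≫ ·)
    (toSheafify_naturality (Opens.grothendieckTopology X) _).symm).trans ?_
  refine (Category.assoc _ _ _).symm.trans ?_
  refine congrArg (· ≫ toSheafify (Opens.grothendieckTopology X)
    (tensorPresheaf (QuotPow I i) M.presheaf)) ?_
  ext U s
  exact congrArg (· ⊗ₜ[A] s) (map_one (Ideal.Quotient.factorₐ A
    (Ideal.pow_le_pow_right (Nat.le_succ (i + 1)))))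

instance : HasLimitsOfShape ℕᵒᵖ (TopCat.Sheaf (ModuleCat.{u} A) X) :=
  inferInstanceAs
    (HasLimitsOfShape ℕᵒᵖ (Sheaf (Opens.grothendieckTopology X) (ModuleCat.{u} A)))

/-- The `I`-adic completion `lim_i (A_i ⊗_A M)`. -/
abbrev completion (I : Ideal A) (M : TopCat.Sheaf (ModuleCat.{u} A) X) :
    TopCat.Sheaf (ModuleCat.{u} A) X :=
  limit (completionSystem I M)

/-- The canonical homomorphism from `M` to its `I`-adic completion. -/
def toCompletion (I : Ideal A) (M : TopCat.Sheaf (ModuleCat.{u} A) X) :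
    M ⟶ completion I M :=
  limit.lift (completionSystem I M)
    { pt := M
      π := NatTrans.ofOpSequence (fun i => toTensor I i M) fun i => by
        simp only [completionSystem, Functor.ofOpSequence_map_homOfLE_succ]
        exact (Category.id_comp (toTensor I i M)).trans (toTensor_comp I M i).symm }

/-- `M` is `I`-adically complete. -/
def IsAdicallyComplete (I : Ideal A) (M : TopCat.Sheaf (ModuleCat.{u} A) X) : Prop :=
  IsIso (toCompletion I M)

/-- The sheaf of abelian groups underlying a sheaf of `A`-modules. -/
def toAb (M : TopCat.Sheaf (ModuleCat.{u} A) X) :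
    Sheaf (Opens.grothendieckTopology X) AddCommGrpCat.{u} :=
  (sheafCompose (Opens.grothendieckTopology X)
    (forget₂ (ModuleCat.{u} A) AddCommGrpCat.{u})).obj M

/-- The open set `U` is `N`-simply connected: `H¹(U, N) = 0`. -/
def IsSimplyConnected (N : Sheaf (Opens.grothendieckTopology X) AddCommGrpCat.{u})
    (U : Opens X) : Prop :=
  Subsingleton (Sheaf.H'.{u} N 1 U)

/-- `X` is locally `N`-simply connected: the `N`-simply connected open sets form a basis. -/
def IsLocallySimplyConnected
    (N : Sheaf (Opens.grothendieckTopology X) AddCommGrpCat.{u}) : Prop :=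
  Opens.IsBasis {U : Opens X | IsSimplyConnected N U}

/-! ### Adic systems -/

variable (X) in
/-- An `I`-adic system of sheaves of `A`-modules on `X`. In `isIso`, the sheaf
`A_i ⊗_A M_{i+1}` is `A_i ⊗_{A_{i+1}} M_{i+1}`, since `A → A_{i+1}` is surjective and the
`A_{i+1}`-module structure of `M_{i+1}` is the one induced from its `A`-module structure. -/
structure AdicSystem (I : Ideal A) where
  /-- The sheaves `M_i`. -/
  obj : ℕ → TopCat.Sheaf (ModuleCat.{u} A) X
  /-- The homomorphisms `ψ_i : M_{i+1} → M_i`. -/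
  ψ : ∀ i, obj (i + 1) ⟶ obj i
  killed : ∀ i, IsKilledBy (I ^ (i + 1)) (obj i)
  isIso : ∀ i, IsIso (inducedHom (killed i) (ψ i))

/-- The sheaf `lim_i M_i`. -/
abbrev AdicSystem.lim {I : Ideal A} (S : AdicSystem X I) : TopCat.Sheaf (ModuleCat.{u} A) X :=
  limit (Functor.ofOpSequence S.ψ)

/-- The projection `lim_i M_i → M_i`. -/
abbrev AdicSystem.proj {I : Ideal A} (S : AdicSystem X I) (i : ℕ) : S.lim ⟶ S.obj i :=
  limit.π (Functor.ofOpSequence S.ψ) (op i)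

end

end AdicSheaf

/-! The system is built from copies of `M_0`. Let `a_1, …, a_r` be minimal generators of `𝔪^(i+1)`.
The kernel of `M_{i+1} → M_0` is `𝔪 M_{i+1}`, which `a_l` kills, so multiplication by `a_l` factors
through a map `M_0 → M_{i+1}`. Flatness of `M_{i+1}` over `A_{i+1}` and minimality of the generators
make `0 → M_0^r → M_{i+1} → M_i → 0` exact (`AdicSystem.exists_shortExact`). If `H¹(U, M_0) = 0`,
this stays exact on sections over `U`, so the modules `Γ(U, M_i)` form a "free tower"
(`AdicSystem.isFreeTower_sections`) with limit `Γ(U, M)`.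

The rest over `U` is algebra. Lift a basis of `E_0 = Γ(U, M_0)` over the residue field to the limit
`P`. Combinations of the lifts with decaying coefficients identify `P` with a module of decaying
functions: injectivity by induction along the graded pieces, surjectivity by successive
approximation (`IsTowerLimit.exists_equiv_decaying`). Artin-Rees lets the coefficients of a decaying
function along finitely many generators be chosen decaying; this gives both the flatness of `P` and
`ker (P → E_i) = 𝔪^(i+1) P`.

Since the simply connected open sets form a basis, these facts pass to stalks, giving flatness of
`M` and `A_i ⊗ M ≅ M_i`. Completeness is then formal: the inverse systems `A_i ⊗ M` and `M_i` are
isomorphic. -/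

namespace AdicSheaf

/-! ### Commutative algebra over a noetherian local ring -/

/-- A finitely generated ideal of a local ring has generators that are linearly independent
modulo `𝔪 I`. -/
lemma exists_minimal_generators {A : Type*} [CommRing A] [IsLocalRing A] (I : Ideal A)
    (hI : I.FG) :
    ∃ (r : ℕ) (a : Fin r → A), Ideal.span (Set.range a) = I ∧
      ∀ c : Fin r → A, ∑ l, c l * a l ∈ IsLocalRing.maximalIdeal A * I →
        ∀ l, c l ∈ IsLocalRing.maximalIdeal A := by
  classical
  have hex : ∃ (r : ℕ), ∃ a : Fin r → A, Ideal.span (Set.range a) = I := by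
    obtain ⟨n, s, hs⟩ := Submodule.fg_iff_exists_fin_generating_family.1 hI
    exact ⟨n, s, hs⟩
  obtain ⟨a, ha⟩ := Nat.find_spec hex
  have hmin : ∀ r' < Nat.find hex, ¬ ∃ a : Fin r' → A, Ideal.span (Set.range a) = I :=
    fun r' h => Nat.find_min hex h
  generalize Nat.find hex = r at a ha hmin
  refine ⟨r, a, ha, fun c hc j => ?_⟩
  by_contra hj
  obtain _ | r := r
  · exact j.elim0
  -- If `c j` were a unit, `a j` would be redundant modulo `𝔪 I`, so by Nakayama the other
  -- generators would suffice, against the minimality of their number.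
  refine hmin r (Nat.lt_succ_self r) ⟨a ∘ j.succAbove, le_antisymm ?_ ?_⟩
  · rw [← ha]
    exact Ideal.span_mono (Set.range_comp_subset_range _ _)
  refine Submodule.le_of_le_smul_of_le_jacobson_bot hI
    (IsLocalRing.maximalIdeal_le_jacobson ⊥) ?_
  conv_lhs => rw [← ha]
  rw [Ideal.span_le]
  rintro _ ⟨l, rfl⟩
  set N := Ideal.span (Set.range (a ∘ j.succAbove)) ⊔ IsLocalRing.maximalIdeal A • I
  have hne : ∀ l, l ≠ j → a l ∈ N := fun l hl => by
    obtain ⟨k, rfl⟩ := Fin.exists_succAbove_eq hl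
    exact le_sup_left (a := Ideal.span (Set.range (a ∘ j.succAbove)))
      (Ideal.subset_span ⟨k, rfl⟩)
  by_cases hl : l = j
  · subst hl
    have hu : IsUnit (c l) := by simpa using hj
    refine (Ideal.unit_mul_mem_iff_mem N hu).1 ?_
    have hN : ∑ k, c k * a k ∈ N :=
      le_sup_right (a := Ideal.span (Set.range (a ∘ l.succAbove))) hc
    rw [← Finset.add_sum_erase _ _ (Finset.mem_univ l)] at hN
    refine (Submodule.add_mem_iff_left _ ?_).1 hN
    exact Submodule.sum_mem _ fun k hk => N.mul_mem_left _ (hne k (Finset.ne_of_mem_erase hk))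
  · exact hne l hl

/-! ### Decaying functions over a noetherian ring -/

section Decaying

variable {A : Type u} [CommRing A] {I : Ideal A}

lemma mem_decaying_iff {Z M : Type u} [AddCommGroup M] [Module A M] {f : Z → M} :
    f ∈ decaying I Z M ↔ ∀ i : ℕ, {z | f z ∉ (I ^ (i + 1) • ⊤ : Submodule A M)}.Finite :=
  Iff.rfl

lemma mem_decaying_self_iff {Z : Type u} {f : Z → A} :
    f ∈ decaying I Z A ↔ ∀ i : ℕ, {z | f z ∉ I ^ (i + 1)}.Finite := by
  simp [mem_decaying_iff]

/-- Functoriality of decaying functions along isomorphisms. -/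
noncomputable def decayingCongr (I : Ideal A) (Z : Type u) {M N : Type u} [AddCommGroup M]
    [Module A M] [AddCommGroup N] [Module A N] (e : M ≃ₗ[A] N) :
    decaying I Z M ≃ₗ[A] decaying I Z N :=
  (LinearEquiv.piCongrRight fun _ : Z => e).ofSubmodules _ _ (by
    have key (J : Ideal A) (x : N) :
        e.symm x ∈ (J • ⊤ : Submodule A M) ↔ x ∈ (J • ⊤ : Submodule A N) := by
      have : (J • ⊤ : Submodule A N) = (J • ⊤ : Submodule A M).map e.toLinearMap := by
        rw [Submodule.map_smul'', Submodule.map_top, LinearEquiv.range]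
      rw [this]
      exact (Submodule.mem_map_equiv (e := e) (p := J • ⊤) (x := x)).symm
    ext f
    refine (Submodule.mem_map_equiv (e := LinearEquiv.piCongrRight fun _ : Z => e)
      (p := decaying I Z M) (x := f)).trans ?_
    refine forall_congr' fun i => ?_
    refine iff_of_eq (congrArg Set.Finite ?_)
    ext z
    exact not_congr (key _ _))

/-- Artin-Rees: coefficients of elements of a submodule of a finite module can be chosen
as small as the element, up to a shift. -/
lemma exists_small_coefficients [IsNoetherianRing A] {L : Type*} [AddCommGroup L] [Module A L]
    [Module.Finite A L] [IsHausdorff I L] {p : ℕ} (k : Fin p → L) :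
    ∃ c : ℕ, ∀ x ∈ Submodule.span A (Set.range k), ∃ y : Fin p → A,
      x = ∑ l, y l • k l ∧ ∀ j, x ∈ (I ^ (j + c) • ⊤ : Submodule A L) → ∀ l, y l ∈ I ^ j := by
  classical
  obtain ⟨c, hc⟩ := Ideal.exists_pow_inf_eq_pow_smul I (Submodule.span A (Set.range k))
  refine ⟨c, fun x hx => ?_⟩
  by_cases h0 : x = 0
  · exact ⟨0, by simp [h0], fun j _ l => by simp⟩
  have hex : ∃ n, x ∉ (I ^ n • ⊤ : Submodule A L) := by
    by_contra! h
    exact h0 (IsHausdorff.haus ‹_› x fun n => by simpa [SModEq.zero] using h n)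
  -- `N` is the first power that `x` leaves. Choosing `y` for the depth `N - 1` serves all `j` at
  -- once: `x ∈ I^(j+c) L` forces `j ≤ N - 1 - c`, and no such `j` exists when `N ≤ c`.
  set N := Nat.find hex
  have hN : x ∉ (I ^ N • ⊤ : Submodule A L) := Nat.find_spec hex
  have hN' : ∀ n < N, x ∈ (I ^ n • ⊤ : Submodule A L) := fun n hn => by
    simpa using Nat.find_min hex hn
  have hlt : ∀ j, x ∈ (I ^ j • ⊤ : Submodule A L) → j < N := fun j hj => by
    by_contra! hle
    exact hN (Submodule.smul_mono_left (Ideal.pow_le_pow_right hle) hj)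
  rcases le_or_gt N c with h | h
  · obtain ⟨y, rfl⟩ := (Submodule.mem_span_range_iff_exists_fun A).1 hx
    exact ⟨y, rfl, fun j hj => absurd (hlt _ hj) (by omega)⟩
  · have hx' : x ∈ I ^ (N - 1 - c) • Submodule.span A (Set.range k) := by
      have : x ∈ (I ^ (N - 1) • ⊤ ⊓ Submodule.span A (Set.range k) : Submodule A L) :=
        ⟨hN' _ (by omega), hx⟩
      rw [hc _ (by omega)] at this
      exact Submodule.smul_mono le_rfl inf_le_right this
    obtain ⟨y, hy, rfl⟩ := (Submodule.mem_ideal_smul_span_iff_exists_sum _ _ _).1 hx'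
    refine ⟨y, Finsupp.sum_fintype _ _ (by simp), fun j hj l => ?_⟩
    have := hlt _ hj
    exact Ideal.pow_le_pow_right (by omega) (hy l)

/-- A decaying function with values in a finitely generated submodule is a combination of
generators with decaying coefficients. -/
lemma exists_decaying_coefficients [IsNoetherianRing A] {L : Type u} [AddCommGroup L] [Module A L]
    [Module.Finite A L] [IsHausdorff I L] {p : ℕ} (k : Fin p → L) {Z : Type u} {f : Z → L}
    (hf : f ∈ decaying I Z L) (hk : ∀ z, f z ∈ Submodule.span A (Set.range k)) :
    ∃ g : Fin p → decaying I Z A, ∀ z, f z = ∑ l, (g l : Z → A) z • k l := by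
  obtain ⟨c, hc⟩ := exists_small_coefficients (I := I) k
  choose y hy hy' using fun z => hc (f z) (hk z)
  refine ⟨fun l => ⟨fun z => y z l, mem_decaying_self_iff.2 fun i => ?_⟩, hy⟩
  refine (hf (i + c)).subset fun z hz h => hz (hy' z (i + 1) ?_ l)
  rwa [show i + 1 + c = i + c + 1 by ring]

lemma coe_sum_smul_decaying {Z : Type u} {n : ℕ} (a : Fin n → A) (f : Fin n → decaying I Z A)
    (z : Z) : ((∑ j, a j • f j : decaying I Z A) : Z → A) z = ∑ j, a j * (f j : Z → A) z := by
  simp [Finset.sum_apply]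

/-- Decaying functions with values in a noetherian separated ring form a flat module. -/
theorem flat_decaying [IsNoetherianRing A] [IsHausdorff I A] (Z : Type u) :
    Module.Flat A (decaying I Z A) := by
  rw [Module.Flat.iff_forall_isTrivialRelation]
  intro n a f haf
  let L := ULift.{u} (Fin n) → A
  have : IsHausdorff I L := ⟨fun x hx => by
    ext j
    refine IsHausdorff.haus ‹IsHausdorff I A› (x j) fun i => ?_
    have := Submodule.mem_map_of_mem (f := LinearMap.proj (R := A) (φ := fun _ => A) j)
      (SModEq.zero.1 (hx i))
    rw [Submodule.map_smul''] at this
    exact SModEq.zero.2 (Submodule.smul_mono le_rfl le_top this)⟩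
  -- The relation `∑ a j • f j = 0` says that the single decaying function `F` takes its values in
  -- the syzygy module `K` of `a`. Decaying coefficients of `F` along generators of `K` trivialize
  -- the relation.
  let F : Z → L := fun z j => (f j.down : Z → A) z
  have hF : F ∈ decaying I Z L := fun i => by
    refine (Set.finite_iUnion fun j => mem_decaying_self_iff.1 (f j).2 i).subset fun z hz => ?_
    by_contra h
    refine hz ?_
    have h' : ∀ j, (f j : Z → A) z ∈ I ^ (i + 1) := by simpa using h
    have hsum : F z = ∑ j, (f j.down : Z → A) z • (Pi.single j 1 : L) := by
      ext k
      simp [F, Finset.sum_apply, Pi.single_apply]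
    rw [hsum]
    exact Submodule.sum_mem _ fun j _ => Submodule.smul_mem_smul (h' _) trivial
  let K : Submodule A L := LinearMap.ker (∑ j, a j.down • LinearMap.proj j : L →ₗ[A] A)
  have hKm (x : L) : x ∈ K ↔ ∑ j, a j * x ⟨j⟩ = 0 := by
    rw [LinearMap.mem_ker]
    simp only [LinearMap.sum_apply, LinearMap.smul_apply, smul_eq_mul]
    rw [← Equiv.ulift.{u}.symm.sum_comp]
    rfl
  obtain ⟨p, k, hk⟩ := Submodule.fg_iff_exists_fin_generating_family.1
    (IsNoetherian.noetherian K)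
  obtain ⟨g, hg⟩ := exists_decaying_coefficients k hF fun z => by
    rw [hk, hKm, ← coe_sum_smul_decaying, haf]
    rfl
  refine ⟨p, fun j l => k l ⟨j⟩, g, fun j => ?_, fun l => ?_⟩
  · ext z
    have := congrFun (hg z) ⟨j⟩
    rw [coe_sum_smul_decaying]
    rw [Finset.sum_apply] at this
    exact this.trans (Finset.sum_congr rfl fun l _ => mul_comm _ _)
  · have : k l ∈ K := hk ▸ Submodule.subset_span ⟨l, rfl⟩
    exact (hKm _).1 this

/-- A decaying function with values in `J` lies in `J • ⊤`. -/
lemma mem_smul_top_decaying [IsNoetherianRing A] [IsHausdorff I A] {Z : Type u} (J : Ideal A)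
    (f : decaying I Z A) (hf : ∀ z, (f : Z → A) z ∈ J) :
    f ∈ (J • ⊤ : Submodule A (decaying I Z A)) := by
  obtain ⟨p, k, hk⟩ := Submodule.fg_iff_exists_fin_generating_family.1 (IsNoetherian.noetherian J)
  obtain ⟨g, hg⟩ := exists_decaying_coefficients k f.2 fun z => hk ▸ hf z
  have : f = ∑ l, k l • g l := by
    ext z
    rw [coe_sum_smul_decaying, hg z]
    simp [mul_comm]
  rw [this]
  exact Submodule.sum_mem _ fun l _ => Submodule.smul_mem_smul
    (hk ▸ Submodule.subset_span ⟨l, rfl⟩) trivial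

end Decaying

/-! ### Towers of modules with adically free limit -/

section Tower

variable {A : Type u} [CommRing A]

/-- A module killed by a maximal ideal has a basis over the residue field. -/
lemma exists_basis_modulo {𝔪 : Ideal A} (h𝔪 : 𝔪.IsMaximal) {N : Type u} [AddCommGroup N]
    [Module A N] (hN : ∀ a ∈ 𝔪, ∀ n : N, a • n = 0) :
    ∃ (Z : Type u) (b : Z → N), (∀ n, ∃ g : Z →₀ A, Finsupp.linearCombination A b g = n) ∧
      ∀ g : Z →₀ A, Finsupp.linearCombination A b g = 0 → ∀ z, g z ∈ 𝔪 := by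
  have hT : Module.IsTorsionBySet A N 𝔪 := fun n a => hN a a.2 n
  let := Ideal.Quotient.field 𝔪
  let : Module (A ⧸ 𝔪) N := hT.module
  have : IsScalarTower A (A ⧸ 𝔪) N := hT.isScalarTower
  let B := Module.Basis.ofVectorSpace (A ⧸ 𝔪) N
  have key (g : Module.Basis.ofVectorSpaceIndex (A ⧸ 𝔪) N →₀ A) :
      Finsupp.linearCombination A B g = Finsupp.linearCombination (A ⧸ 𝔪) B
        (g.mapRange (Ideal.Quotient.mk 𝔪) (map_zero _)) := by
    rw [Finsupp.linearCombination_apply, Finsupp.linearCombination_apply,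
      Finsupp.sum_mapRange_index (by simp)]
    refine Finsupp.sum_congr fun z _ => ?_
    exact (algebraMap_smul (A ⧸ 𝔪) (g z) (B z)).symm
  refine ⟨_, B, fun n => ?_, fun g hg z => ?_⟩
  · obtain ⟨g, hg⟩ := Finsupp.mapRange_surjective (Ideal.Quotient.mk 𝔪) (map_zero _)
      Ideal.Quotient.mk_surjective (B.repr n)
    exact ⟨g, by rw [key, hg, B.linearCombination_repr]⟩
  · rw [key] at hg
    have := linearIndependent_iff.1 B.linearIndependent _ hg
    exact Ideal.Quotient.eq_zero_iff_mem.1 (by simpa using DFunLike.congr_fun this z)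

lemma linearCombination_congr {J : Ideal A} {Z N : Type*} [AddCommGroup N] [Module A N]
    (hN : ∀ a ∈ J, ∀ n : N, a • n = 0) (b : Z → N) {g g' : Z →₀ A}
    (h : ∀ z, g z - g' z ∈ J) :
    Finsupp.linearCombination A b g = Finsupp.linearCombination A b g' := by
  rw [← sub_eq_zero, ← map_sub, Finsupp.linearCombination_apply]
  exact Finset.sum_eq_zero fun z _ => hN _ (h z) _

/-- Coefficients are chosen pointwise, and equal to zero wherever `g` vanishes, so that they stay
finitely supported. -/
lemma exists_finsupp_coefficients {Z : Type*} {r : ℕ} (a : Fin r → A) (g : Z →₀ A)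
    (hg : ∀ z, g z ∈ Ideal.span (Set.range a)) :
    ∃ C : Fin r → Z →₀ A, g = ∑ l, a l • C l := by
  classical
  have (z : Z) : ∃ c : Fin r → A, ∑ l, a l * c l = g z ∧ (g z = 0 → c = 0) := by
    by_cases h : g z = 0
    · exact ⟨0, by simp [h], fun _ => rfl⟩
    · obtain ⟨c, hc⟩ := (Submodule.mem_span_range_iff_exists_fun A).1 (hg z)
      exact ⟨c, by simpa [mul_comm] using hc, fun h' => absurd h' h⟩
  choose c hc hc' using this
  refine ⟨fun l => Finsupp.onFinset g.support (fun z => c z l) fun z hz => ?_, ?_⟩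
  · rw [Finsupp.mem_support_iff]
    intro h
    exact hz (by rw [hc' z h]; rfl)
  · ext z
    simp [Finsupp.finsetSum_apply, hc]

/-- The values of a decaying function that are not in `I ^ (i + 1)`. -/
noncomputable def truncate {I : Ideal A} {Z : Type u} (i : ℕ) (f : decaying I Z A) : Z →₀ A := by
  classical
  exact Finsupp.onFinset (mem_decaying_self_iff.1 f.2 i).toFinset
    (fun z => if (f : Z → A) z ∈ I ^ (i + 1) then 0 else (f : Z → A) z) (by simp +contextual)

lemma truncate_sub_mem {I : Ideal A} {Z : Type u} (i : ℕ) (f : decaying I Z A) (z : Z) :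
    truncate i f z - (f : Z → A) z ∈ I ^ (i + 1) := by
  classical
  simp only [truncate, Finsupp.onFinset_apply]
  split_ifs with h
  · simpa using h
  · simp

variable {E : ℕ → Type u} [∀ i, AddCommGroup (E i)] [∀ i, Module A (E i)]

/-- The composite `E_i → E_0` of the transition maps. -/
def towerToZero (ψ : ∀ i, E (i + 1) →ₗ[A] E i) : ∀ i, E i →ₗ[A] E 0
  | 0 => LinearMap.id
  | i + 1 => towerToZero ψ i ∘ₗ ψ i

/-- A tower of modules `E_i` with surjective transition maps, such that `E_i` is killed by
`𝔪 ^ (i + 1)`, and such that the kernel of `E_{i+1} → E_i` is `(𝔪^(i+1) / 𝔪^(i+2)) ⊗ E_0`,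
expressed in terms of generators of `𝔪 ^ (i + 1)`. -/
structure IsFreeTower (𝔪 : Ideal A) (ψ : ∀ i, E (i + 1) →ₗ[A] E i) : Prop where
  smul_eq_zero : ∀ i, ∀ a ∈ 𝔪 ^ (i + 1), ∀ s : E i, a • s = 0
  surjective : ∀ i, Function.Surjective (ψ i)
  smul_eq_zero_of_toZero : ∀ i, ∀ a ∈ 𝔪 ^ (i + 1), ∀ s : E (i + 1),
    towerToZero ψ (i + 1) s = 0 → a • s = 0
  exists_generators : ∀ i, ∃ (r : ℕ) (a : Fin r → A), Ideal.span (Set.range a) = 𝔪 ^ (i + 1) ∧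
    (∀ s, ψ i s = 0 → ∃ t : Fin r → E (i + 1), s = ∑ l, a l • t l) ∧
    ∀ t : Fin r → E (i + 1), ∑ l, a l • t l = 0 → ∀ l, towerToZero ψ (i + 1) (t l) = 0

/-- `P` is the inverse limit of the tower `E`. -/
structure IsTowerLimit (ψ : ∀ i, E (i + 1) →ₗ[A] E i) {P : Type u} [AddCommGroup P] [Module A P]
    (π : ∀ i, P →ₗ[A] E i) : Prop where
  comm : ∀ i x, ψ i (π (i + 1) x) = π i x
  ext : ∀ x y, (∀ i, π i x = π i y) → x = y
  exists_lift : ∀ e : ∀ i, E i, (∀ i, ψ i (e (i + 1)) = e i) → ∃ x, ∀ i, π i x = e i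

namespace IsTowerLimit

variable {ψ : ∀ i, E (i + 1) →ₗ[A] E i} {P : Type u} [AddCommGroup P] [Module A P]
  {π : ∀ i, P →ₗ[A] E i}

lemma toZero_comm (hP : IsTowerLimit ψ π) (i : ℕ) (x : P) : towerToZero ψ i (π i x) = π 0 x := by
  induction i with
  | zero => rfl
  | succ i ih => rw [← ih, ← hP.comm i]; rfl

lemma proj_zero_surjective (hP : IsTowerLimit ψ π) (hψ : ∀ i, Function.Surjective (ψ i)) :
    Function.Surjective (π 0) := by
  intro y
  choose σ hσ using hψ
  obtain ⟨x, hx⟩ := hP.exists_lift (fun n => Nat.rec y (fun n e => σ n e) n) fun i => hσ _ _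
  exact ⟨x, hx 0⟩

/-- The error of a lift from level `i` is `∑ a l • t l`. As `a l • t l` depends only on the image of
`t l` in `E 0`, and `P → E 0` is surjective, the error is itself in the image of `P`. -/
lemma proj_surjective {𝔪 : Ideal A} (hE : IsFreeTower 𝔪 ψ) (hP : IsTowerLimit ψ π) (i : ℕ) :
    Function.Surjective (π i) := by
  have h0 := hP.proj_zero_surjective hE.surjective
  induction i with
  | zero => exact h0
  | succ i ih =>
    intro y
    obtain ⟨x, hx⟩ := ih (ψ i y)
    obtain ⟨r, a, ha, hs, -⟩ := hE.exists_generators i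
    obtain ⟨t, ht⟩ := hs (y - π (i + 1) x) (by rw [map_sub, hP.comm, hx, sub_self])
    choose w hw using fun l => h0 (towerToZero ψ (i + 1) (t l))
    refine ⟨x + ∑ l, a l • w l, ?_⟩
    rw [map_add, ← eq_sub_iff_add_eq', ht, map_sum]
    refine Finset.sum_congr rfl fun l _ => ?_
    rw [map_smul, ← sub_eq_zero, ← smul_sub]
    refine hE.smul_eq_zero_of_toZero i _ (ha ▸ Ideal.subset_span ⟨l, rfl⟩) _ ?_
    rw [map_sub, hP.toZero_comm, hw, sub_self]

section

variable {𝔪 : Ideal A} (hE : IsFreeTower 𝔪 ψ) (hP : IsTowerLimit ψ π) {Z : Type u} (b : Z → P)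
include hE hP

/-- The combination of the elements `b z` with decaying coefficients. -/
lemma exists_combination (f : decaying 𝔪 Z A) :
    ∃ x : P, ∀ i, π i x = π i (Finsupp.linearCombination A b (truncate i f)) := by
  refine hP.exists_lift _ fun i => ?_
  rw [hP.comm, Finsupp.apply_linearCombination, Finsupp.apply_linearCombination]
  refine linearCombination_congr (hE.smul_eq_zero i) _ fun z => ?_
  rw [← sub_sub_sub_cancel_right _ _ ((f : Z → A) z)]
  exact Submodule.sub_mem _
    (Ideal.pow_le_pow_right (Nat.le_succ _) (truncate_sub_mem (i + 1) f z)) (truncate_sub_mem i f z)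

/-- The linear map sending a decaying function `f` to `∑ z, f z • b z`. -/
noncomputable def combination : decaying 𝔪 Z A →ₗ[A] P :=
  -- At level `i` only coefficients modulo `𝔪^(i+1)` matter, so linearity holds although truncation
  -- is not additive.
  have key (i : ℕ) (g g' : Z →₀ A) (h : ∀ z, g z - g' z ∈ 𝔪 ^ (i + 1)) :
      π i (Finsupp.linearCombination A b g) = π i (Finsupp.linearCombination A b g') := by
    rw [Finsupp.apply_linearCombination, Finsupp.apply_linearCombination]
    exact linearCombination_congr (hE.smul_eq_zero i) _ h
  { toFun f := (exists_combination hE hP b f).choose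
    map_add' f f' := hP.ext _ _ fun i => by
      rw [map_add, (exists_combination hE hP b _).choose_spec,
        (exists_combination hE hP b _).choose_spec, (exists_combination hE hP b _).choose_spec,
        ← map_add, ← map_add]
      refine key i _ _ fun z => ?_
      have h₁ := truncate_sub_mem i (f + f') z
      have h₂ := truncate_sub_mem i f z
      have h₃ := truncate_sub_mem i f' z
      convert Submodule.sub_mem _ h₁ (Submodule.add_mem _ h₂ h₃) using 1
      simp
      ring
    map_smul' c f := hP.ext _ _ fun i => by
      rw [RingHom.id_apply, map_smul, (exists_combination hE hP b _).choose_spec,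
        (exists_combination hE hP b _).choose_spec, ← map_smul, ← map_smul]
      refine key i _ _ fun z => ?_
      have h₁ := truncate_sub_mem i (c • f) z
      have h₂ := truncate_sub_mem i f z
      convert Submodule.sub_mem _ h₁ (Ideal.mul_mem_left _ c h₂) using 1
      simp
      ring }

/-- Frees later arguments from the particular truncation used in the construction. -/
lemma proj_combination (i : ℕ) (f : decaying 𝔪 Z A) (g : Z →₀ A)
    (hg : ∀ z, g z - (f : Z → A) z ∈ 𝔪 ^ (i + 1)) :
    π i (combination hE hP b f) = π i (Finsupp.linearCombination A b g) := by
  refine ((exists_combination hE hP b f).choose_spec i).trans ?_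
  rw [Finsupp.apply_linearCombination, Finsupp.apply_linearCombination]
  refine linearCombination_congr (hE.smul_eq_zero i) _ fun z => ?_
  rw [← sub_sub_sub_cancel_right _ _ ((f : Z → A) z)]
  exact Submodule.sub_mem _ (truncate_sub_mem i f z) (hg z)

variable {b}

/-- The graded induction behind injectivity. Once `g` has values in `𝔪^(i+1)`, write `g = ∑ a l • C
l`. Vanishing in `E (i + 1)` makes the combination of each `C l` vanish in `E 0`, and independence
there puts the values of `C l` in `𝔪`. -/
lemma coefficient_mem
    (hb : ∀ g : Z →₀ A, Finsupp.linearCombination A (π 0 ∘ b) g = 0 → ∀ z, g z ∈ 𝔪)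
    (i : ℕ) (g : Z →₀ A) (hg : π i (Finsupp.linearCombination A b g) = 0) (z : Z) :
    g z ∈ 𝔪 ^ (i + 1) := by
  induction i generalizing g z with
  | zero =>
    rw [Finsupp.apply_linearCombination] at hg
    simpa using hb g hg z
  | succ i ih =>
    obtain ⟨r, a, ha, -, ht⟩ := hE.exists_generators i
    obtain ⟨C, rfl⟩ := exists_finsupp_coefficients a g fun z => by
      rw [ha]
      exact ih g (by rw [← hP.comm, hg, map_zero]) z
    simp only [map_sum, map_smul] at hg
    have h0 := ht _ hg
    simp only [Finsupp.finsetSum_apply, Finsupp.smul_apply, smul_eq_mul]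
    refine Submodule.sum_mem _ fun l _ => ?_
    rw [pow_succ]
    refine Ideal.mul_mem_mul (ha ▸ Ideal.subset_span ⟨l, rfl⟩) (hb (C l) ?_ z)
    rw [← Finsupp.apply_linearCombination, ← hP.toZero_comm (i + 1)]
    exact h0 l

/-- One step of successive approximation: the image of `x` in `E (i + 1)` is `∑ a l • t l`, and each
`t l` may be replaced by a combination of the `b z` with the same image in `E 0`. -/
lemma exists_correction
    (hb : ∀ n, ∃ g : Z →₀ A, Finsupp.linearCombination A (π 0 ∘ b) g = n)
    (i : ℕ) (x : P) (hx : π i x = 0) : ∃ g : Z →₀ A, (∀ z, g z ∈ 𝔪 ^ (i + 1)) ∧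
      π (i + 1) (Finsupp.linearCombination A b g) = π (i + 1) x := by
  obtain ⟨r, a, ha, hs, -⟩ := hE.exists_generators i
  have hal (l : Fin r) : a l ∈ 𝔪 ^ (i + 1) := ha ▸ Ideal.subset_span ⟨l, rfl⟩
  obtain ⟨t, ht⟩ := hs (π (i + 1) x) (by rw [hP.comm, hx])
  choose g hg using fun l => hb (towerToZero ψ (i + 1) (t l))
  refine ⟨∑ l, a l • g l, fun z => ?_, ?_⟩
  · simp only [Finsupp.finsetSum_apply, Finsupp.smul_apply, smul_eq_mul]
    exact Submodule.sum_mem _ fun l _ => Ideal.mul_mem_right _ _ (hal l)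
  · rw [ht]
    simp only [map_sum, map_smul]
    refine Finset.sum_congr rfl fun l _ => ?_
    rw [← sub_eq_zero, ← smul_sub]
    refine hE.smul_eq_zero_of_toZero i _ (hal l) _ ?_
    rw [map_sub, hP.toZero_comm, Finsupp.apply_linearCombination, hg, sub_self]

end

/-- The limit of a free tower is isomorphic to a module of decaying functions. -/
theorem exists_equiv_decaying {𝔪 : Ideal A} (h𝔪 : 𝔪.IsMaximal) [IsAdicComplete 𝔪 A]
    (hE : IsFreeTower 𝔪 ψ) (hP : IsTowerLimit ψ π) :
    ∃ (Z : Type u) (e : decaying 𝔪 Z A ≃ₗ[A] P),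
      ∀ i f, π i (e f) = 0 → ∀ z, (f : Z → A) z ∈ 𝔪 ^ (i + 1) := by
  obtain ⟨Z, b₀, hspan, hind⟩ := exists_basis_modulo h𝔪 fun a ha (s : E 0) =>
    hE.smul_eq_zero 0 a (by simpa using ha) s
  choose b hb using fun z => hP.proj_zero_surjective hE.surjective (b₀ z)
  obtain rfl : π 0 ∘ b = b₀ := funext hb
  have hker (i : ℕ) (f : decaying 𝔪 Z A) (hf : π i (combination hE hP b f) = 0) (z : Z) :
      (f : Z → A) z ∈ 𝔪 ^ (i + 1) := by
    have h := truncate_sub_mem i f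
    rw [proj_combination hE hP b i f _ h] at hf
    exact (Submodule.sub_mem_iff_right _ (coefficient_mem hE hP hind i _ hf z)).1 (h z)
  have hinj : Function.Injective (combination hE hP b) := by
    rw [← LinearMap.ker_eq_bot, LinearMap.ker_eq_bot']
    intro f hf
    ext z
    refine IsHausdorff.haus (I := 𝔪) inferInstance _ fun n => SModEq.zero.2 ?_
    rw [smul_eq_mul, Ideal.mul_top]
    exact Ideal.pow_le_pow_right (Nat.le_succ n) (hker n f (by rw [hf, map_zero]) z)
  have hsurj : Function.Surjective (combination hE hP b) := by
    intro x
    have step (i : ℕ) (g : {g : Z →₀ A // π i (Finsupp.linearCombination A b g) = π i x}) :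
        ∃ g' : {g : Z →₀ A // π (i + 1) (Finsupp.linearCombination A b g) = π (i + 1) x},
          ∀ z, g'.1 z - g.1 z ∈ 𝔪 ^ (i + 1) := by
      obtain ⟨d, hd, hd'⟩ := exists_correction hE hP hspan i
        (x - Finsupp.linearCombination A b g.1) (by rw [map_sub, g.2, sub_self])
      exact ⟨⟨g.1 + d, by rw [map_add, map_add, hd', map_sub]; abel⟩, fun z => by
        simpa using hd z⟩
    obtain ⟨g₀, hg₀⟩ := hspan (π 0 x)
    choose next hnext using step
    let G : ∀ i, {g : Z →₀ A // π i (Finsupp.linearCombination A b g) = π i x} := fun i =>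
      Nat.rec ⟨g₀, by rw [Finsupp.apply_linearCombination, hg₀]⟩ next i
    have hG (i : ℕ) (z : Z) : (G (i + 1)).1 z - (G i).1 z ∈ 𝔪 ^ (i + 1) := hnext i (G i) z
    have hG' (i j : ℕ) (h : i ≤ j) (z : Z) : (G j).1 z - (G i).1 z ∈ 𝔪 ^ (i + 1) := by
      induction j, h using Nat.le_induction with
      | base => simp
      | succ j hij ih =>
        rw [← sub_add_sub_cancel _ ((G j).1 z)]
        exact Submodule.add_mem _ (Ideal.pow_le_pow_right (by omega) (hG j z)) ih
    have hlim (z : Z) : ∃ y : A, ∀ i, (G i).1 z - y ∈ 𝔪 ^ (i + 1) := by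
      -- The sequence is shifted by one, since `G i` is determined modulo `𝔪^(i+1)` while the Cauchy
      -- condition at `m` is modulo `𝔪^m`. At `m = 0` the condition is empty.
      obtain ⟨y, hy⟩ := IsPrecomplete.prec (I := 𝔪) (M := A) inferInstance
        (f := fun n => (G (n - 1)).1 z) (fun {m n} hmn => by
          rw [SModEq.sub_mem, smul_eq_mul, Ideal.mul_top, ← neg_mem_iff, neg_sub]
          obtain _ | m := m
          · simp
          · exact hG' m (n - 1) (by omega) z)
      refine ⟨y, fun i => ?_⟩
      have := hy (i + 1)
      rwa [SModEq.sub_mem, smul_eq_mul, Ideal.mul_top] at this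
    choose f hf using hlim
    -- Off the finite support of `G i`, the limit lies in `𝔪^(i+1)`.
    have hdec : f ∈ decaying 𝔪 Z A := mem_decaying_self_iff.2 fun i =>
      (G i).1.hasFiniteSupport.subset fun z hz h0 => hz <| by
        have := hf z i
        rwa [h0, zero_sub, neg_mem_iff] at this
    refine ⟨⟨f, hdec⟩, hP.ext _ _ fun i => ?_⟩
    rw [proj_combination hE hP b i ⟨f, hdec⟩ (G i).1 fun z => hf z i, (G i).2]
  exact ⟨Z, LinearEquiv.ofBijective _ ⟨hinj, hsurj⟩, hker⟩

variable {𝔪 : Ideal A} (h𝔪 : 𝔪.IsMaximal) [IsAdicComplete 𝔪 A]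
  (hE : IsFreeTower 𝔪 ψ) (hP : IsTowerLimit ψ π)
include h𝔪 hE hP

theorem isAdicallyFree : IsAdicallyFree 𝔪 P := by
  obtain ⟨Z, e, -⟩ := exists_equiv_decaying h𝔪 hE hP
  exact ⟨Z, ⟨e.symm.trans (decayingCongr 𝔪 Z (AdicCompletion.ofLinearEquiv 𝔪 A))⟩⟩

theorem flat [IsNoetherianRing A] : Module.Flat A P := by
  obtain ⟨Z, e, -⟩ := exists_equiv_decaying h𝔪 hE hP
  have := flat_decaying (I := 𝔪) Z
  exact Module.Flat.of_linearEquiv e.symm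

/-- The coefficients of `x` lie in `𝔪^(i+1)` pointwise; Artin-Rees, through `mem_smul_top_decaying`,
turns this into a finite sum of multiples. -/
theorem mem_smul_top_of_proj_eq_zero [IsNoetherianRing A] (i : ℕ) (x : P) (hx : π i x = 0) :
    x ∈ (𝔪 ^ (i + 1) • ⊤ : Submodule A P) := by
  obtain ⟨Z, e, he⟩ := exists_equiv_decaying h𝔪 hE hP
  obtain ⟨f, rfl⟩ := e.surjective x
  have := Submodule.mem_map_of_mem (f := e.toLinearMap)
    (mem_smul_top_decaying (𝔪 ^ (i + 1)) f (he i f hx))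
  rw [Submodule.map_smul''] at this
  exact Submodule.smul_mono le_rfl le_top this

end IsTowerLimit

end Tower

/-! ### Stalks of sheaves of modules -/

section Stalk

variable {A : Type u} [CommRing A] {X : TopCat.{u}}

/-- The linear map on stalks induced by a morphism of presheaves of modules. -/
noncomputable abbrev stalkMap {P Q : TopCat.Presheaf (ModuleCat.{u} A) X} (φ : P ⟶ Q) (x : X) :
    P.stalk x →ₗ[A] Q.stalk x :=
  ((TopCat.Presheaf.stalkFunctor (ModuleCat.{u} A) x).map φ).hom

lemma stalkMap_germ {P Q : TopCat.Presheaf (ModuleCat.{u} A) X} (φ : P ⟶ Q) (x : X)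
    (U : Opens X) (hx : x ∈ U) (s : P.obj (op U)) :
    stalkMap φ x (P.germ U x hx s) = Q.germ U x hx (φ.app (op U) s) :=
  TopCat.Presheaf.stalkFunctor_map_germ_apply U x hx φ s

lemma stalkMap_comp {P Q R : TopCat.Presheaf (ModuleCat.{u} A) X} (φ : P ⟶ Q) (χ : Q ⟶ R)
    (x : X) (e : P.stalk x) : stalkMap (φ ≫ χ) x e = stalkMap χ x (stalkMap φ x e) := by
  rw [stalkMap, Functor.map_comp]
  rfl

lemma exists_res_eq_zero {P : TopCat.Presheaf (ModuleCat.{u} A) X} {x : X} {U : Opens X}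
    (hx : x ∈ U) (s : P.obj (op U)) (hs : P.germ U x hx s = 0) :
    ∃ (V : Opens X) (_ : x ∈ V) (i : V ⟶ U), P.map i.op s = 0 := by
  obtain ⟨V, hV, i, j, h⟩ := P.germ_eq x hx hx s 0 (by rw [hs, map_zero])
  exact ⟨V, hV, i, by rw [h, map_zero]⟩

lemma exists_eq_one_tmul {I : Ideal A} {N : Type u} [AddCommGroup N] [Module A N]
    (w : (A ⧸ I) ⊗[A] N) : ∃ n : N, w = 1 ⊗ₜ n := by
  induction w with
  | zero => exact ⟨0, by simp⟩
  | tmul a n =>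
    obtain ⟨a, rfl⟩ := Ideal.Quotient.mk_surjective a
    refine ⟨a • n, ?_⟩
    rw [← TensorProduct.smul_tmul, ← Algebra.algebraMap_eq_smul_one]
    rfl
  | add w w' h h' =>
    obtain ⟨n, rfl⟩ := h
    obtain ⟨n', rfl⟩ := h'
    exact ⟨n + n', by rw [TensorProduct.tmul_add]⟩

lemma mem_smul_top_of_one_tmul_eq_zero {I : Ideal A} {N : Type u} [AddCommGroup N] [Module A N]
    (n : N) (h : (1 : A ⧸ I) ⊗ₜ[A] n = 0) : n ∈ (I • ⊤ : Submodule A N) := by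
  have := congrArg (TensorProduct.quotTensorEquivQuotSMul N I) h
  rw [map_zero, ← map_one (Ideal.Quotient.mk I),
    TensorProduct.quotTensorEquivQuotSMul_mk_tmul, one_smul] at this
  simpa using this

lemma smul_quotient_tensor {I : Ideal A} {N : Type u} [AddCommGroup N] [Module A N]
    (a : A) (ha : a ∈ I) (w : (A ⧸ I) ⊗[A] N) : a • w = 0 := by
  obtain ⟨n, rfl⟩ := exists_eq_one_tmul w
  rw [TensorProduct.smul_tmul', ← Algebra.algebraMap_eq_smul_one]
  have : algebraMap A (A ⧸ I) a = 0 := Ideal.Quotient.eq_zero_iff_mem.2 ha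
  rw [this, TensorProduct.zero_tmul]

/-- The homomorphism `s ↦ 1 ⊗ s` of presheaves. -/
noncomputable def oneTensor (I : Ideal A) (P : TopCat.Presheaf (ModuleCat.{u} A) X) :
    P ⟶ tensorPresheaf (A ⧸ I) P where
  app U := ModuleCat.ofHom (TensorProduct.mk A (A ⧸ I) (P.obj U) 1)
  naturality U V f := by
    ext s
    rfl

lemma smul_stalk_tensorPresheaf (I : Ideal A) (P : TopCat.Presheaf (ModuleCat.{u} A) X) (x : X)
    (a : A) (ha : a ∈ I) (w : (tensorPresheaf (A ⧸ I) P).stalk x) : a • w = 0 := by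
  obtain ⟨U, hx, w, rfl⟩ := (tensorPresheaf (A ⧸ I) P).exists_germ_eq w
  have := smul_quotient_tensor a ha w
  rw [← map_smul]
  exact (congrArg _ this).trans (map_zero _)

variable {I : Ideal A} {M L : TopCat.Sheaf (ModuleCat.{u} A) X} (hL : IsKilledBy I L)
  (φ : M ⟶ L)

lemma inducedPresheafHom_app_one_tmul (U : Opens X) (s : M.presheaf.obj (op U)) :
    (inducedPresheafHom hL φ).app (op U) ((1 : A ⧸ I) ⊗ₜ[A] s) = φ.hom.app (op U) s := by
  refine (inducedLinearMap_tmul (hL.isTorsionBySet (op U)) (φ.hom.app (op U)).hom 1 s).trans ?_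
  rw [one_smul]

lemma toSheafify_inducedHom :
    toSheafify (Opens.grothendieckTopology X) (tensorPresheaf (A ⧸ I) M.presheaf) ≫
      (inducedHom hL φ).hom = inducedPresheafHom hL φ :=
  toSheafify_sheafifyLift _ _ _

/-- `(A / I) ⊗ M → L` is an isomorphism if and only if, on stalks, `M → L` is surjective with
kernel `I M`. -/
lemma isIso_inducedHom_iff :
    IsIso (inducedHom hL φ) ↔ ∀ x : X, Function.Surjective (stalkMap φ.hom x) ∧
      ∀ e, stalkMap φ.hom x e = 0 → e ∈ (I • ⊤ : Submodule A (M.presheaf.stalk x)) := by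
  -- Sheafification does not change stalks, so the unsheafified map can be tested instead.
  have hbij : IsIso (inducedHom hL φ) ↔
      ∀ x : X, Function.Bijective (stalkMap (inducedPresheafHom hL φ) x) := by
    rw [TopCat.Presheaf.isIso_iff_stalkFunctor_map_iso]
    refine forall_congr' fun x => ?_
    have h := TopCat.Presheaf.stalkFunctor_map_unit_toSheafify_isIso x (ModuleCat.{u} A)
      (tensorPresheaf (A ⧸ I) M.presheaf)
    have hcomp := Functor.map_comp (TopCat.Presheaf.stalkFunctor (ModuleCat.{u} A) x)
      (toSheafify (Opens.grothendieckTopology X) (tensorPresheaf (A ⧸ I) M.presheaf))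
      (inducedHom hL φ).hom
    rw [toSheafify_inducedHom] at hcomp
    refine Iff.trans ?_ (ConcreteCategory.isIso_iff_bijective
      ((TopCat.Presheaf.stalkFunctor (ModuleCat.{u} A) x).map (inducedPresheafHom hL φ)))
    rw [hcomp]
    exact (@isIso_comp_left_iff _ _ _ _ _ _ _ h).symm
  rw [hbij]
  refine forall_congr' fun x => ?_
  have key (e : M.presheaf.stalk x) : stalkMap (inducedPresheafHom hL φ) x
      (stalkMap (oneTensor I M.presheaf) x e) = stalkMap φ.hom x e := by
    obtain ⟨U, hx, s, rfl⟩ := M.presheaf.exists_germ_eq e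
    rw [stalkMap_germ, stalkMap_germ, stalkMap_germ]
    exact congrArg _ (inducedPresheafHom_app_one_tmul hL φ U s)
  -- Together with `hker`, this presents the stalk of the tensor presheaf as the quotient of the
  -- stalk of `M` by `I` times it.
  have hone : Function.Surjective (stalkMap (oneTensor I M.presheaf) x) := by
    intro w
    obtain ⟨U, hx, w, rfl⟩ := (tensorPresheaf (A ⧸ I) M.presheaf).exists_germ_eq w
    obtain ⟨n, rfl⟩ := exists_eq_one_tmul w
    exact ⟨M.presheaf.germ U x hx n, stalkMap_germ _ _ _ _ _⟩
  have hker (e : M.presheaf.stalk x) : stalkMap (oneTensor I M.presheaf) x e = 0 ↔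
      e ∈ (I • ⊤ : Submodule A (M.presheaf.stalk x)) := by
    constructor
    · obtain ⟨U, hx, s, rfl⟩ := M.presheaf.exists_germ_eq e
      intro h
      rw [stalkMap_germ] at h
      obtain ⟨V, hV, i, h⟩ := exists_res_eq_zero hx _ h
      have hs := mem_smul_top_of_one_tmul_eq_zero (M.presheaf.map i.op s) h
      have := Submodule.mem_map_of_mem (f := (M.presheaf.germ V x hV).hom) hs
      rw [Submodule.map_smul''] at this
      rw [← M.presheaf.germ_res_apply i x hV s]
      exact Submodule.smul_mono le_rfl le_top this
    · intro h
      induction h using Submodule.smul_induction_on' with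
      | smul a ha e he => rw [map_smul, smul_stalk_tensorPresheaf _ _ _ _ ha]
      | add e _ e' _ h h' => rw [map_add, h, h', add_zero]
  constructor
  · rintro ⟨hi, hs⟩
    refine ⟨fun y => ?_, fun e he => (hker e).1 (hi ?_)⟩
    · obtain ⟨w, rfl⟩ := hs y
      obtain ⟨e, rfl⟩ := hone w
      exact ⟨e, (key e).symm⟩
    · rw [key, he, map_zero]
  · rintro ⟨hs, hi⟩
    refine ⟨(injective_iff_map_eq_zero _).2 fun w hw => ?_, fun y => ?_⟩
    · obtain ⟨e, rfl⟩ := hone w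
      rw [key] at hw
      exact (hker e).2 (hi e hw)
    · obtain ⟨e, rfl⟩ := hs y
      exact ⟨_, key e⟩

end Stalk

/-! ### The graded pieces of an adic system -/

section Graded

variable {A : Type u} [CommRing A] {X : TopCat.{u}}

/-- Multiplication by a scalar on a sheaf of modules. -/
def smulHom (a : A) (M : TopCat.Sheaf (ModuleCat.{u} A) X) : M ⟶ M :=
  ⟨{ app := fun U => ModuleCat.ofHom (a • (LinearMap.id : M.presheaf.obj U →ₗ[A] M.presheaf.obj U))
     naturality := fun U V f => by
      ext s
      exact (map_smul (M.presheaf.map f).hom a s).symm }⟩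

lemma stalkMap_smulHom (a : A) (M : TopCat.Sheaf (ModuleCat.{u} A) X) (x : X)
    (e : M.presheaf.stalk x) : stalkMap (smulHom a M).hom x e = a • e := by
  obtain ⟨U, hx, s, rfl⟩ := M.presheaf.exists_germ_eq e
  rw [stalkMap_germ, ← map_smul]
  rfl

lemma sheafHom_ext {M L : TopCat.Sheaf (ModuleCat.{u} A) X} {φ χ : M ⟶ L}
    (h : ∀ (U : Opens X) (s : M.presheaf.obj (op U)), φ.hom.app (op U) s = χ.hom.app (op U) s) :
    φ = χ := by
  apply Sheaf.hom_ext
  ext U s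
  exact h U.unop s

lemma hom_sum_apply {ι : Type*} [Fintype ι] {N N' : ModuleCat.{u} A} (f : ι → (N ⟶ N')) (n : N) :
    (∑ l, f l) n = ∑ l, f l n := by
  change (∑ l, f l).hom n = _
  rw [ModuleCat.hom_sum, LinearMap.sum_apply]

lemma section_eq_zero_of_germ {M : TopCat.Sheaf (ModuleCat.{u} A) X} {U : Opens X}
    (s : M.presheaf.obj (op U)) (h : ∀ x (hx : x ∈ U), M.presheaf.germ U x hx s = 0) : s = 0 :=
  TopCat.Presheaf.section_ext M U s 0 fun x hx => by rw [map_zero]; exact h x hx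

lemma epi_of_stalkMap_surjective {M L : TopCat.Sheaf (ModuleCat.{u} A) X} (φ : M ⟶ L)
    (h : ∀ x, Function.Surjective (stalkMap φ.hom x)) : Epi φ := by
  rw [← TopCat.Sheaf.isLocallySurjective_iff_epi,
    TopCat.Presheaf.locally_surjective_iff_surjective_on_stalks]
  exact h

lemma mono_of_stalkMap {M L : TopCat.Sheaf (ModuleCat.{u} A) X} (φ : M ⟶ L)
    (h : ∀ x e, stalkMap φ.hom x e = 0 → e = 0) : Mono φ := by
  rw [TopCat.Presheaf.mono_iff_stalk_mono]
  intro x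
  exact (ModuleCat.mono_iff_injective _).2 ((injective_iff_map_eq_zero _).2 (h x))

noncomputable instance : HasFiniteBiproducts (TopCat.Sheaf (ModuleCat.{u} A) X) :=
  Abelian.hasFiniteBiproducts

lemma exists_sum_of_mem_span_smul_top {N : Type*} [AddCommGroup N] [Module A N] {r : ℕ}
    (a : Fin r → A) {e : N} (he : e ∈ (Ideal.span (Set.range a) • ⊤ : Submodule A N)) :
    ∃ t : Fin r → N, e = ∑ l, a l • t l := by
  induction he using Submodule.smul_induction_on' with
  | smul c hc e _ =>
    obtain ⟨c, rfl⟩ := (Submodule.mem_span_range_iff_exists_fun A).1 hc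
    refine ⟨fun l => c l • e, ?_⟩
    rw [Finset.sum_smul]
    exact Finset.sum_congr rfl fun l _ => by rw [smul_smul, smul_eq_mul, mul_comm]
  | add e _ e' _ h h' =>
    obtain ⟨t, rfl⟩ := h
    obtain ⟨t', rfl⟩ := h'
    exact ⟨t + t', by simp [smul_add, Finset.sum_add_distrib]⟩

variable {𝔪 : Ideal A}

/-! ### Kernels of the projections to `M_0` -/

namespace AdicSystem

variable (S : AdicSystem X 𝔪)

/-- The composite `M_i → M_0` of the transition maps. -/
noncomputable def toZero : ∀ i, S.obj i ⟶ S.obj 0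
  | 0 => 𝟙 _
  | i + 1 => S.ψ i ≫ toZero i

lemma stalk_smul_eq_zero (i : ℕ) (x : X) {a : A} (ha : a ∈ 𝔪 ^ (i + 1))
    (e : (S.obj i).presheaf.stalk x) : a • e = 0 := by
  have h := (S.killed i).isTorsionBySet_stalk x
  exact @h e ⟨a, ha⟩

lemma stalk_surjective (i : ℕ) (x : X) : Function.Surjective (stalkMap (S.ψ i).hom x) :=
  ((isIso_inducedHom_iff (S.killed i) (S.ψ i)).1 (S.isIso i) x).1

lemma stalk_mem_of_ψ_eq_zero (i : ℕ) (x : X) (e : (S.obj (i + 1)).presheaf.stalk x)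
    (he : stalkMap (S.ψ i).hom x e = 0) :
    e ∈ (𝔪 ^ (i + 1) • ⊤ : Submodule A ((S.obj (i + 1)).presheaf.stalk x)) :=
  ((isIso_inducedHom_iff (S.killed i) (S.ψ i)).1 (S.isIso i) x).2 e he

lemma stalkMap_toZero_succ (i : ℕ) (x : X) (e : (S.obj (i + 1)).presheaf.stalk x) :
    stalkMap (S.toZero (i + 1)).hom x e =
      stalkMap (S.toZero i).hom x (stalkMap (S.ψ i).hom x e) :=
  stalkMap_comp (S.ψ i).hom (S.toZero i).hom x e

lemma stalkMap_toZero_zero (x : X) (e : (S.obj 0).presheaf.stalk x) :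
    stalkMap (S.toZero 0).hom x e = e := by
  have := (TopCat.Presheaf.stalkFunctor (ModuleCat.{u} A) x).map_id (S.obj 0).presheaf
  exact ConcreteCategory.congr_hom this e

lemma stalk_toZero_surjective (i : ℕ) (x : X) :
    Function.Surjective (stalkMap (S.toZero i).hom x) := by
  induction i with
  | zero => exact fun e => ⟨e, S.stalkMap_toZero_zero x e⟩
  | succ i ih =>
    intro e
    obtain ⟨e, rfl⟩ := ih e
    obtain ⟨e, rfl⟩ := S.stalk_surjective i x e
    exact ⟨e, S.stalkMap_toZero_succ i x e⟩

/-- By induction the image of `e` one level down lies in `𝔪` times the stalk. Lift it to `𝔪` times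
the upper stalk; the difference lies in `ker ψ`, hence in `𝔪^(i+1)` times that stalk. -/
lemma stalk_mem_of_toZero_eq_zero (i : ℕ) (x : X) (e : (S.obj i).presheaf.stalk x)
    (he : stalkMap (S.toZero i).hom x e = 0) :
    e ∈ (𝔪 • ⊤ : Submodule A ((S.obj i).presheaf.stalk x)) := by
  induction i with
  | zero =>
    rw [stalkMap_toZero_zero] at he
    exact he ▸ Submodule.zero_mem _
  | succ i ih =>
    rw [stalkMap_toZero_succ] at he
    have h := ih _ he
    rw [← LinearMap.range_eq_top.2 (S.stalk_surjective i x), ← Submodule.map_top,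
      ← Submodule.map_smul''] at h
    obtain ⟨e', he', h⟩ := h
    rw [← sub_add_cancel e e']
    refine Submodule.add_mem _ (Submodule.smul_mono_left (Ideal.pow_le_self (Nat.succ_ne_zero i))
      (S.stalk_mem_of_ψ_eq_zero i x _ ?_)) he'
    rw [map_sub, h, sub_self]

lemma stalk_smul_eq_zero_of_toZero (i : ℕ) (x : X) {a : A} (ha : a ∈ 𝔪 ^ (i + 1))
    (e : (S.obj (i + 1)).presheaf.stalk x) (he : stalkMap (S.toZero (i + 1)).hom x e = 0) :
    a • e = 0 := by
  have := S.stalk_mem_of_toZero_eq_zero (i + 1) x e he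
  clear he
  induction this using Submodule.smul_induction_on' with
  | smul c hc e _ =>
    rw [smul_smul]
    exact S.stalk_smul_eq_zero (i + 1) x (Ideal.mul_mem_mul ha hc) e
  | add e _ e' _ h h' => rw [smul_add, h, h', add_zero]

/-- Checked on germs: `s` is known to lie in `𝔪 M_{i+1}` only stalkwise, but vanishing of `a • s` is
local. -/
lemma smul_eq_zero_of_toZero (i : ℕ) {a : A} (ha : a ∈ 𝔪 ^ (i + 1)) (U : Opens X)
    (s : (S.obj (i + 1)).presheaf.obj (op U)) (hs : (S.toZero (i + 1)).hom.app (op U) s = 0) :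
    a • s = 0 := by
  refine section_eq_zero_of_germ _ fun x hx => ?_
  rw [map_smul]
  refine S.stalk_smul_eq_zero_of_toZero i x ha _ ?_
  rw [stalkMap_germ]
  exact (congrArg _ hs).trans (map_zero _)

lemma toZero_epi (i : ℕ) : Epi (S.toZero i) :=
  epi_of_stalkMap_surjective _ (S.stalk_toZero_surjective i)

/-- For `a ∈ 𝔪 ^ (i + 1)`, the homomorphism `M_0 → M_{i+1}` induced by multiplication by `a`
on `M_{i+1}`. -/
lemma exists_mulHom (i : ℕ) {a : A} (ha : a ∈ 𝔪 ^ (i + 1)) :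
    ∃ μ : S.obj 0 ⟶ S.obj (i + 1), S.toZero (i + 1) ≫ μ = smulHom a _ := by
  have := S.toZero_epi (i + 1)
  refine ⟨Abelian.epiDesc (S.toZero (i + 1)) (smulHom a _) ?_, Abelian.comp_epiDesc _ _ _⟩
  refine sheafHom_ext fun U s => ?_
  refine S.smul_eq_zero_of_toZero i ha U _ ?_
  exact congrArg (fun f : kernel (S.toZero (i + 1)) ⟶ S.obj 0 => f.hom.app (op U) s)
    (kernel.condition (S.toZero (i + 1)))

end AdicSystem

/-- Equational criterion over a quotient ring. -/
lemma exists_equations {J : Ideal A} {N : Type u} [AddCommGroup N] [Module A N]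
    (hN : Module.IsTorsionBySet A N J)
    (hflat : letI : Module (A ⧸ J) N := hN.module; Module.Flat (A ⧸ J) N)
    {r : ℕ} (a : Fin r → A) (e : Fin r → N) (h : ∑ l, a l • e l = 0) :
    ∃ (k : ℕ) (c : Fin r → Fin k → A) (y : Fin k → N), (∀ l, e l = ∑ j, c l j • y j) ∧
      ∀ j, ∑ l, a l * c l j ∈ J := by
  let : Module (A ⧸ J) N := hN.module
  have : IsScalarTower A (A ⧸ J) N := hN.isScalarTower
  obtain ⟨k, c, y, hc, hy⟩ := Module.Flat.iff_forall_isTrivialRelation.1 hflat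
    (f := fun l => Ideal.Quotient.mk J (a l)) (x := e)
    ((Finset.sum_congr rfl fun l _ => algebraMap_smul (A ⧸ J) (a l) (e l)).trans h)
  choose c' hc' using fun l j => Ideal.Quotient.mk_surjective (c l j)
  refine ⟨k, c', y, fun l => ?_, fun j => ?_⟩
  · rw [hc l]
    refine Finset.sum_congr rfl fun j _ => ?_
    rw [← hc' l j]
    exact algebraMap_smul (A ⧸ J) (c' l j) (y j)
  · rw [← Ideal.Quotient.eq_zero_iff_mem, map_sum, ← hy j]
    exact Finset.sum_congr rfl fun l _ => by rw [map_mul, hc' l j]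

namespace AdicSystem

variable (S : AdicSystem X 𝔪)

lemma stalk_toZero_smul (i : ℕ) (x : X) {a : A} (ha : a ∈ 𝔪)
    (e : (S.obj i).presheaf.stalk x) : a • stalkMap (S.toZero i).hom x e = 0 :=
  S.stalk_smul_eq_zero 0 x (by simpa using ha) _

/-- If the `a l` are generators of `𝔪 ^ (i + 1)` that are independent modulo `𝔪 ^ (i + 2)`,
a relation between them on a stalk of the flat sheaf `M_{i+1}` has coefficients in the kernel
of the projection to `M_0`. -/
lemma stalk_toZero_eq_zero_of_sum (hflat : ∀ i, IsFlatOverQuotient (S.killed i)) (i : ℕ) (x : X)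
    {r : ℕ} (a : Fin r → A) (ha : ∀ c : Fin r → A, ∑ l, c l * a l ∈ 𝔪 * 𝔪 ^ (i + 1) →
      ∀ l, c l ∈ 𝔪)
    (e : Fin r → (S.obj (i + 1)).presheaf.stalk x) (h : ∑ l, a l • e l = 0) (l : Fin r) :
    stalkMap (S.toZero (i + 1)).hom x (e l) = 0 := by
  obtain ⟨k, c, y, hy, hc⟩ := exists_equations
    ((S.killed (i + 1)).isTorsionBySet_stalk x) (hflat (i + 1) x) a e h
  rw [hy l, map_sum]
  refine Finset.sum_eq_zero fun j _ => ?_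
  rw [map_smul]
  -- Column `j` of the matrix from flatness satisfies `∑ a l * c l j ∈ 𝔪^(i+2)`, so minimality puts
  -- its entries in `𝔪`, which kills `M_0`.
  refine S.stalk_toZero_smul (i + 1) x (ha (fun l => c l j) ?_ l) _
  rw [← pow_succ']
  simpa only [mul_comm] using hc j

/-- The sheaf of modules `M_0 ^ r`. -/
noncomputable abbrev zeroPow (r : ℕ) : TopCat.Sheaf (ModuleCat.{u} A) X :=
  ⨁ fun _ : Fin r => S.obj 0

/-- Additivity of the stalk functor gives coordinates on the stalk of `M_0^r` without identifying it
with a power of the stalk of `M_0`. -/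
lemma stalk_total (r : ℕ) (x : X) (e : (S.zeroPow r).presheaf.stalk x) :
    ∑ l, stalkMap (biproduct.ι (fun _ : Fin r => S.obj 0) l).hom x
      (stalkMap (biproduct.π (fun _ : Fin r => S.obj 0) l).hom x e) = e := by
  have h := congrArg
    (TopCat.Sheaf.forget _ X ⋙ TopCat.Presheaf.stalkFunctor (ModuleCat.{u} A) x).map
    (biproduct.total (f := fun _ : Fin r => S.obj 0))
  rw [Functor.map_sum, CategoryTheory.Functor.map_id] at h
  refine Eq.trans ?_ ((hom_sum_apply _ e).symm.trans (ConcreteCategory.congr_hom h e))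
  refine Finset.sum_congr rfl fun l _ => ?_
  rw [← stalkMap_comp]
  rfl

/-- The short exact sequence `0 → M_0 ^ r → M_{i+1} → M_i → 0`, where `r` is the number of
minimal generators of `𝔪 ^ (i + 1)`. -/
lemma exists_shortExact [IsLocalRing A] [IsNoetherianRing A] (h𝔪 : 𝔪 = IsLocalRing.maximalIdeal A)
    (hflat : ∀ i, IsFlatOverQuotient (S.killed i)) (i : ℕ) :
    ∃ (r : ℕ) (a : Fin r → A) (μ : Fin r → (S.obj 0 ⟶ S.obj (i + 1)))
      (w : biproduct.desc μ ≫ S.ψ i = 0),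
      Ideal.span (Set.range a) = 𝔪 ^ (i + 1) ∧
      (∀ l, S.toZero (i + 1) ≫ μ l = smulHom (a l) _) ∧
      (ShortComplex.mk _ _ w).ShortExact := by
  obtain ⟨r, a, ha, hmin⟩ := exists_minimal_generators (𝔪 ^ (i + 1)) (IsNoetherian.noetherian _)
  rw [← h𝔪] at hmin
  have hal (l : Fin r) : a l ∈ 𝔪 ^ (i + 1) := ha ▸ Ideal.subset_span ⟨l, rfl⟩
  choose μ hμ using fun l => S.exists_mulHom i (hal l)
  have hμx (x : X) (l : Fin r) (e : (S.obj (i + 1)).presheaf.stalk x) :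
      stalkMap (μ l).hom x (stalkMap (S.toZero (i + 1)).hom x e) = a l • e := by
    rw [← stalkMap_comp, ← stalkMap_smulHom, ← hμ l]
    rfl
  have hdesc (x : X) (e : Fin r → (S.obj 0).presheaf.stalk x) :
      stalkMap (biproduct.desc μ).hom x
        (∑ l, stalkMap (biproduct.ι (fun _ : Fin r => S.obj 0) l).hom x (e l)) =
      ∑ l, stalkMap (μ l).hom x (e l) := by
    rw [map_sum]
    refine Finset.sum_congr rfl fun l _ => ?_
    rw [← stalkMap_comp]
    exact congrArg (fun f : S.obj 0 ⟶ S.obj (i + 1) => stalkMap f.hom x (e l))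
      (biproduct.ι_desc μ l)
  have w : biproduct.desc μ ≫ S.ψ i = 0 := by
    have := S.toZero_epi (i + 1)
    ext l : 1
    rw [biproduct.ι_desc_assoc, comp_zero, ← cancel_epi (S.toZero (i + 1)), ← Category.assoc,
      hμ l, comp_zero]
    refine sheafHom_ext fun U s => ?_
    refine (map_smul ((S.ψ i).hom.app (op U)).hom (a l) s).trans ?_
    exact S.killed i U (a l) _ (hal l)
  have hmono : Mono (biproduct.desc μ) := by
    refine mono_of_stalkMap _ fun x e he => ?_
    -- Lifting the coordinates of `e` to `M_{i+1}` turns `e ↦ 0` into a relation `∑ a l • e' l = 0`,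
    -- to which flatness and minimality apply.
    choose e' he' using fun l => S.stalk_toZero_surjective (i + 1) x
      (stalkMap (biproduct.π (fun _ : Fin r => S.obj 0) l).hom x e)
    rw [← S.stalk_total r x e, hdesc] at he
    simp_rw [← he', hμx] at he
    have := S.stalk_toZero_eq_zero_of_sum hflat i x a hmin e' he
    rw [← S.stalk_total r x e]
    refine Finset.sum_eq_zero fun l _ => ?_
    rw [← he', this, map_zero]
  have hepi : Epi (S.ψ i) := epi_of_stalkMap_surjective _ (S.stalk_surjective i)
  refine ⟨r, a, μ, w, ha, hμ, ⟨?_⟩⟩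
  rw [TopCat.Sheaf.exact_iff_stalkFunctor_map_exact]
  intro x
  rw [ShortComplex.moduleCat_exact_iff]
  intro e he
  have h := S.stalk_mem_of_ψ_eq_zero i x e he
  rw [← ha] at h
  obtain ⟨t, ht⟩ := exists_sum_of_mem_span_smul_top a h
  refine ⟨∑ l, stalkMap (biproduct.ι (fun _ : Fin r => S.obj 0) l).hom x
    (stalkMap (S.toZero (i + 1)).hom x (t l)), ?_⟩
  refine (hdesc x _).trans ?_
  rw [ht]
  exact Finset.sum_congr rfl fun l _ => hμx x l (t l)

end AdicSystem

end Graded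

/-! ### Vanishing of cohomology and lifting of sections -/

section Cohomology

variable {X : TopCat.{u}}

/-- The free abelian sheaf generated by an open set. -/
noncomputable abbrev freeSheaf (U : Opens X) :
    Sheaf (Opens.grothendieckTopology X) AddCommGrpCat.{u} :=
  (yoneda ⋙ (Functor.whiskeringRight _ _ _).obj
      AddCommGrpCat.free ⋙ presheafToSheaf (Opens.grothendieckTopology X) _).obj U

/-- The tautological section of the free abelian sheaf on `U`. -/
noncomputable def freeSection (U : Opens X) : (freeSheaf U).obj.obj (op U) :=
  (toSheafify (Opens.grothendieckTopology X) (yoneda.obj U ⋙ AddCommGrpCat.free)).app (op U)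
    (FreeAbelianGroup.of (𝟙 U))

/-- Yoneda, the free-forgetful adjunction and sheafification combined. -/
lemma exists_hom_freeSection (F : Sheaf (Opens.grothendieckTopology X) AddCommGrpCat.{u})
    (U : Opens X) (s : F.obj.obj (op U)) :
    ∃ f : freeSheaf U ⟶ F, f.hom.app (op U) (freeSection U) = s := by
  let p : yoneda.obj U ⋙ AddCommGrpCat.free ⟶ F.obj :=
    { app := fun V => AddCommGrpCat.ofHom (FreeAbelianGroup.lift fun i => F.obj.map i.op s)
      naturality := fun V W j => by
        apply AddCommGrpCat.hom_ext
        refine FreeAbelianGroup.lift_ext _ _ fun i => ?_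
        have h₁ : FreeAbelianGroup.lift (fun i : unop W ⟶ U => F.obj.map i.op s)
            (FreeAbelianGroup.map (fun i : unop V ⟶ U => j.unop ≫ i) (FreeAbelianGroup.of i)) =
            F.obj.map (j.unop ≫ i).op s := by
          rw [FreeAbelianGroup.map_of_apply, FreeAbelianGroup.lift_apply_of]
        refine h₁.trans ?_
        refine Eq.trans ?_ (congrArg (F.obj.map j) (FreeAbelianGroup.lift_apply_of _ i).symm)
        rw [op_comp, Functor.map_comp]
        rfl }
  refine ⟨⟨sheafifyLift (Opens.grothendieckTopology X) p F.property⟩, ?_⟩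
  have h := toSheafify_sheafifyLift (Opens.grothendieckTopology X) p F.property
  refine (ConcreteCategory.congr_hom (congr_app h (op U)) (FreeAbelianGroup.of (𝟙 U))).trans ?_
  refine (FreeAbelianGroup.lift_apply_of _ _).trans ?_
  exact ConcreteCategory.congr_hom (F.obj.map_id (op U)) s

/-- View `s` as a map from the free sheaf on `U`. The obstruction to lifting it along `T.g` is its
image under the connecting map to `Ext¹`, which vanishes. -/
lemma exists_lift_of_ext_eq_zero
    {T : ShortComplex (Sheaf (Opens.grothendieckTopology X) AddCommGrpCat.{u})}
    (hT : T.ShortExact) (U : Opens X)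
    (h : ∀ x : Abelian.Ext.{u} (freeSheaf U) T.X₁ 1, x = 0) (s : T.X₃.obj.obj (op U)) :
    ∃ t : T.X₂.obj.obj (op U), T.g.hom.app (op U) t = s := by
  obtain ⟨f, rfl⟩ := exists_hom_freeSection T.X₃ U s
  obtain ⟨y, hy⟩ := Abelian.Ext.covariant_sequence_exact₃ (freeSheaf U) hT (Abelian.Ext.mk₀ f)
    (zero_add 1) (h _)
  obtain ⟨g, rfl⟩ := (Abelian.Ext.mk₀_bijective _ _).2 y
  rw [Abelian.Ext.mk₀_comp_mk₀] at hy
  obtain rfl := (Abelian.Ext.mk₀_bijective _ _).1 hy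
  exact ⟨g.hom.app (op U) (freeSection U), rfl⟩

variable {A : Type u} [CommRing A]

/-- The functor underlying `toAb`. -/
noncomputable abbrev toAbFunctor (A : Type u) [CommRing A] (X : TopCat.{u}) :
    TopCat.Sheaf (ModuleCat.{u} A) X ⥤
      Sheaf (Opens.grothendieckTopology X) AddCommGrpCat.{u} :=
  sheafCompose (Opens.grothendieckTopology X) (forget₂ (ModuleCat.{u} A) AddCommGrpCat.{u})

instance : (toAbFunctor A X).Additive where
  map_add {M L φ χ} := by
    apply Sheaf.hom_ext
    ext U s
    rfl

/-- Sections over an open set. -/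
noncomputable abbrev sectionsFunctor (A : Type u) [CommRing A] {X : TopCat.{u}} (U : Opens X) :
    TopCat.Sheaf (ModuleCat.{u} A) X ⥤ ModuleCat.{u} A :=
  TopCat.Sheaf.forget (ModuleCat.{u} A) X ⋙ (evaluation _ _).obj (op U)

instance (U : Opens X) : (sectionsFunctor A U).Additive where
  map_add := rfl

instance (U : Opens X) (K : Type) [SmallCategory K] :
    PreservesLimitsOfShape K (sectionsFunctor A U) := by
  have : PreservesLimitsOfSize.{0, 0} (TopCat.Sheaf.forget (ModuleCat.{u} A) X) :=
    (sheafificationAdjunction (Opens.grothendieckTopology X)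
      (ModuleCat.{u} A)).rightAdjoint_preservesLimits
  have : PreservesLimitsOfShape K ((evaluation (Opens X)ᵒᵖ (ModuleCat.{u} A)).obj (op U)) :=
    evaluation_preservesLimitsOfShape (op U)
  exact @comp_preservesLimitsOfShape _ _ _ _ _ _ _ _ _ _ inferInstance this

lemma exists_section_of_exact {T : ShortComplex (TopCat.Sheaf (ModuleCat.{u} A) X)}
    (hT : T.ShortExact) (U : Opens X) (s : T.X₂.presheaf.obj (op U))
    (hs : T.g.hom.app (op U) s = 0) : ∃ t, T.f.hom.app (op U) t = s := by
  have h := hT.exact.map_of_mono_of_preservesKernel (sectionsFunctor A U) hT.mono_f inferInstance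
  rw [ShortComplex.moduleCat_exact_iff] at h
  exact h s hs

lemma section_injective_of_mono {M L : TopCat.Sheaf (ModuleCat.{u} A) X} (φ : M ⟶ L) [Mono φ]
    (U : Opens X) : Function.Injective (φ.hom.app (op U)) := by
  have : Mono ((sectionsFunctor A U).map φ) := inferInstance
  exact (ModuleCat.mono_iff_injective _).1 this

/-- Needed because cohomology is taken of abelian sheaves. All three conditions can be read from
sections, where forgetting scalars changes nothing; for exactness, a germ in the kernel is
represented on an open set where its image vanishes. -/
lemma toAb_shortExact {T : ShortComplex (TopCat.Sheaf (ModuleCat.{u} A) X)}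
    (hT : T.ShortExact) : (T.map (toAbFunctor A X)).ShortExact := by
  have := hT.mono_f
  have hepi := hT.epi_g
  have h1 : Mono ((toAbFunctor A X).map T.f) := by
    have hinj (V : (Opens X)ᵒᵖ) : Function.Injective (((toAbFunctor A X).map T.f).hom.app V) :=
      section_injective_of_mono T.f V.unop
    exact Sheaf.mono_of_injective _ hinj
  have h2 : Epi ((toAbFunctor A X).map T.g) := by
    refine (TopCat.Sheaf.isLocallySurjective_iff_epi (C := AddCommGrpCat.{u}) (X := X)
      ((toAbFunctor A X).map T.g)).1 ?_
    rw [← TopCat.Sheaf.isLocallySurjective_iff_epi,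
      TopCat.Presheaf.isLocallySurjective_iff] at hepi
    rw [TopCat.Presheaf.isLocallySurjective_iff]
    exact hepi
  have hex : (T.map (toAbFunctor A X)).Exact := by
    refine (TopCat.Sheaf.exact_iff_stalkFunctor_map_exact (C := AddCommGrpCat.{u}) (X := X) _).2 fun x => ?_
    rw [ShortComplex.ab_exact_iff]
    intro e he
    obtain ⟨U, hx, s, rfl⟩ := TopCat.Presheaf.exists_germ_eq (C := AddCommGrpCat.{u}) (X := X)
      ((toAbFunctor A X).obj T.X₂).obj e
    have he' := (TopCat.Presheaf.stalkFunctor_map_germ_apply (C := AddCommGrpCat.{u}) U x hx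
      ((toAbFunctor A X).map T.g).hom s).symm.trans he
    obtain ⟨V, hV, i, j, h⟩ := TopCat.Presheaf.germ_eq (C := AddCommGrpCat.{u})
      ((toAbFunctor A X).obj T.X₃).obj x hx hx _ 0 (he'.trans (map_zero _).symm)
    obtain ⟨t, ht⟩ := exists_section_of_exact hT V (T.X₂.presheaf.map i.op s) (by
      refine (ConcreteCategory.congr_hom (T.g.hom.naturality i.op) s).trans ?_
      exact h.trans (map_zero _))
    refine ⟨TopCat.Presheaf.germ ((toAbFunctor A X).obj T.X₁).obj V x hV t, ?_⟩
    refine (TopCat.Presheaf.stalkFunctor_map_germ_apply (C := AddCommGrpCat.{u}) V x hV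
      ((toAbFunctor A X).map T.f).hom t).trans ?_
    refine (congrArg (TopCat.Presheaf.germ ((toAbFunctor A X).obj T.X₂).obj V x hV) ht).trans ?_
    exact TopCat.Presheaf.germ_res_apply ((toAbFunctor A X).obj T.X₂).obj i x hV s
  exact { exact := hex, mono_f := h1, epi_g := h2 }

/-- The identity of `M_0^r` is a sum of maps through `M_0`, so every class is a sum of classes
factoring through `Ext¹` with values in `M_0`. -/
lemma ext_eq_zero_of_zeroPow {𝔪 : Ideal A} (S : AdicSystem X 𝔪) (U : Opens X)
    (hU : IsSimplyConnected (toAb (S.obj 0)) U) (r : ℕ)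
    (x : Abelian.Ext.{u} (freeSheaf U) ((toAbFunctor A X).obj (S.zeroPow r)) 1) : x = 0 := by
  have hU' (y : Abelian.Ext.{u} (freeSheaf U) ((toAbFunctor A X).obj (S.obj 0)) 1) : y = 0 :=
    hU.elim y 0
  have h := congrArg (toAbFunctor A X).map (biproduct.total (f := fun _ : Fin r => S.obj 0))
  rw [Functor.map_sum, CategoryTheory.Functor.map_id] at h
  rw [← x.comp_mk₀_id, ← h, Abelian.Ext.mk₀_sum, Abelian.Ext.comp_sum]
  refine Finset.sum_eq_zero fun l _ => ?_
  rw [Functor.map_comp, ← Abelian.Ext.mk₀_comp_mk₀, ← Abelian.Ext.comp_assoc_of_third_deg_zero,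
    hU' (x.comp _ _), Abelian.Ext.zero_comp]

end Cohomology

/-! ### Sections of adic systems and of their limits -/

namespace AdicSystem

variable {A : Type u} [CommRing A] {X : TopCat.{u}} {𝔪 : Ideal A} (S : AdicSystem X 𝔪)

/-- The transition maps on sections over an open set. -/
noncomputable abbrev sectionsMap (U : Opens X) (i : ℕ) :
    (S.obj (i + 1)).presheaf.obj (op U) →ₗ[A] (S.obj i).presheaf.obj (op U) :=
  ((S.ψ i).hom.app (op U)).hom

/-- The projections from the sections of the limit. -/
noncomputable abbrev sectionsProj (U : Opens X) (i : ℕ) :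
    S.lim.presheaf.obj (op U) →ₗ[A] (S.obj i).presheaf.obj (op U) :=
  ((S.proj i).hom.app (op U)).hom

lemma towerToZero_sectionsMap (U : Opens X) (i : ℕ) (s : (S.obj i).presheaf.obj (op U)) :
    towerToZero (E := fun i => (S.obj i).presheaf.obj (op U)) (S.sectionsMap U) i s =
      (S.toZero i).hom.app (op U) s := by
  induction i with
  | zero => rfl
  | succ i ih => exact ih _

lemma proj_ψ (i : ℕ) : S.proj (i + 1) ≫ S.ψ i = S.proj i := by
  have := limit.w (Functor.ofOpSequence S.ψ) (homOfLE (Nat.le_succ i)).op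
  rwa [Functor.ofOpSequence_map_homOfLE_succ] at this

lemma isTowerLimit_sections (U : Opens X) :
    IsTowerLimit (E := fun i => (S.obj i).presheaf.obj (op U)) (S.sectionsMap U)
      (S.sectionsProj U) := by
  have hlim := isLimitOfPreserves (sectionsFunctor A U) (limit.isLimit (Functor.ofOpSequence S.ψ))
  refine ⟨fun i x => ?_, fun x y h => ?_, fun e he => ?_⟩
  · exact congrArg (fun f : S.lim ⟶ S.obj i => f.hom.app (op U) x) (S.proj_ψ i)
  -- Elements are treated as linear maps from `A`, so that the universal property of the limit
  -- applies to them.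
  · have : ModuleCat.ofHom (LinearMap.toSpanSingleton A (S.lim.presheaf.obj (op U)) x) =
        ModuleCat.ofHom (LinearMap.toSpanSingleton A (S.lim.presheaf.obj (op U)) y) := by
      refine hlim.hom_ext fun j => ?_
      apply ModuleCat.hom_ext
      refine LinearMap.ext_ring ?_
      have hx := h j.unop
      rw [← one_smul A x, ← one_smul A y] at hx
      exact hx
    have := ConcreteCategory.congr_hom this (1 : A)
    simpa using this
  · let c : Cone (Functor.ofOpSequence S.ψ ⋙ sectionsFunctor A U) :=
      { pt := ModuleCat.of A A
        π := NatTrans.ofOpSequence (fun i => ModuleCat.ofHom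
            (LinearMap.toSpanSingleton A ((S.obj i).presheaf.obj (op U)) (e i))) fun i => by
          refine (Category.id_comp _).trans ?_
          rw [Functor.comp_map, Functor.ofOpSequence_map_homOfLE_succ]
          apply ModuleCat.hom_ext
          refine LinearMap.ext_ring ?_
          refine (one_smul A (e i)).trans ((he i).symm.trans ?_)
          exact congrArg (S.sectionsMap U i) (one_smul A (e (i + 1))).symm }
    refine ⟨hlim.lift c (1 : A), fun i => ?_⟩
    refine (ConcreteCategory.congr_hom (hlim.fac c (op i)) (1 : A)).trans ?_
    exact one_smul A (e i)

variable [IsLocalRing A] [IsNoetherianRing A]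

/-- Vanishing of `H¹(U, M_0^r)` makes every transition map surjective on sections. Then sections of
`M_0` lift to `M_{i+1}`, which rewrites `Γ(U, M_0)^r ≅ ker` in terms of the generators `a l`. -/
lemma isFreeTower_sections (h𝔪 : 𝔪 = IsLocalRing.maximalIdeal A)
    (hflat : ∀ i, IsFlatOverQuotient (S.killed i)) (U : Opens X)
    (hU : IsSimplyConnected (toAb (S.obj 0)) U) :
    IsFreeTower (E := fun i => (S.obj i).presheaf.obj (op U)) 𝔪 (S.sectionsMap U) := by
  have hsurj (i : ℕ) : Function.Surjective (S.sectionsMap U i) := by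
    obtain ⟨r, a, μ, w, -, -, hT⟩ := S.exists_shortExact h𝔪 hflat i
    exact exists_lift_of_ext_eq_zero (toAb_shortExact hT) U (ext_eq_zero_of_zeroPow S U hU r)
  have hsurj0 (i : ℕ) : Function.Surjective ((S.toZero i).hom.app (op U)) := by
    induction i with
    | zero => exact fun s => ⟨s, rfl⟩
    | succ i ih => exact ih.comp (hsurj i)
  refine ⟨fun i a ha s => S.killed i U a s ha, hsurj, fun i a ha s hs => ?_, fun i => ?_⟩
  · exact S.smul_eq_zero_of_toZero i ha U s ((S.towerToZero_sectionsMap U (i + 1) s).symm.trans hs)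
  · obtain ⟨r, a, μ, w, ha, hμ, hT⟩ := S.exists_shortExact h𝔪 hflat i
    have hmono := hT.mono_f
    have hμs (l : Fin r) (s : (S.obj (i + 1)).presheaf.obj (op U)) :
        (μ l).hom.app (op U) ((S.toZero (i + 1)).hom.app (op U) s) = a l • s :=
      congrArg (fun f : S.obj (i + 1) ⟶ S.obj (i + 1) => f.hom.app (op U) s) (hμ l)
    have hdesc (t : Fin r → (S.obj 0).presheaf.obj (op U)) :
        (biproduct.desc μ).hom.app (op U)
          (∑ l, (biproduct.ι (fun _ : Fin r => S.obj 0) l).hom.app (op U) (t l)) =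
        ∑ l, (μ l).hom.app (op U) (t l) := by
      rw [map_sum]
      refine Finset.sum_congr rfl fun l _ => ?_
      exact congrArg (fun f : S.obj 0 ⟶ S.obj (i + 1) => f.hom.app (op U) (t l))
        (biproduct.ι_desc μ l)
    refine ⟨r, a, ha, fun s hs => ?_, fun t ht l => ?_⟩
    · obtain ⟨t, rfl⟩ := exists_section_of_exact hT U s hs
      have htot : ∑ l, (biproduct.ι (fun _ : Fin r => S.obj 0) l).hom.app (op U)
          ((biproduct.π (fun _ : Fin r => S.obj 0) l).hom.app (op U) t) = t := by
        have h := congrArg (sectionsFunctor A U).map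
          (biproduct.total (f := fun _ : Fin r => S.obj 0))
        rw [Functor.map_sum, CategoryTheory.Functor.map_id] at h
        exact (hom_sum_apply _ t).symm.trans (ConcreteCategory.congr_hom h t)
      choose t' ht' using fun l => hsurj0 (i + 1)
        ((biproduct.π (fun _ : Fin r => S.obj 0) l).hom.app (op U) t)
      refine ⟨t', ?_⟩
      simp_rw [← hμs, ht', ← hdesc, htot]
    · rw [towerToZero_sectionsMap]
      have h0 : ∑ l, (biproduct.ι (fun _ : Fin r => S.obj 0) l).hom.app (op U)
          ((S.toZero (i + 1)).hom.app (op U) (t l)) = 0 := by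
        refine section_injective_of_mono (biproduct.desc μ) U ?_
        rw [hdesc, map_zero, ← ht]
        exact Finset.sum_congr rfl fun l _ => hμs l (t l)
      have h1 := congrArg ((biproduct.π (fun _ : Fin r => S.obj 0) l).hom.app (op U)) h0
      rw [map_sum, map_zero, Finset.sum_eq_single l] at h1
      · refine Eq.trans ?_ h1
        exact congrArg (fun f : S.obj 0 ⟶ S.obj 0 => f.hom.app (op U)
          ((S.toZero (i + 1)).hom.app (op U) (t l)))
          (biproduct.ι_π_self (fun _ : Fin r => S.obj 0) l).symm
      · intro k _ hk
        exact congrArg (fun f : S.obj 0 ⟶ S.obj 0 => f.hom.app (op U)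
          ((S.toZero (i + 1)).hom.app (op U) (t k)))
          (biproduct.ι_π_ne (fun _ : Fin r => S.obj 0) hk)
      · exact fun h => absurd (Finset.mem_univ l) h

end AdicSystem

/-! ### Flatness, completeness and reductions of the limit -/

/-- If the sections of a sheaf over a basis of open sets are flat, the sheaf is flat. -/
lemma isFlat_of_isBasis {A : Type u} [CommRing A] {X : TopCat.{u}}
    (M : TopCat.Sheaf (ModuleCat.{u} A) X) {B : Set (Opens X)} (hB : Opens.IsBasis B)
    (h : ∀ U ∈ B, Module.Flat A (M.presheaf.obj (op U))) : IsFlat M := by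
  intro x
  rw [Module.Flat.iff_forall_isTrivialRelation]
  intro n a e he
  have key (n : ℕ) (e : Fin n → M.presheaf.stalk x) : ∃ (V : Opens X) (hx : x ∈ V)
      (s : Fin n → M.presheaf.obj (op V)), ∀ l, M.presheaf.germ V x hx (s l) = e l := by
    induction n with
    | zero => exact ⟨⊤, trivial, fun l => l.elim0, fun l => l.elim0⟩
    | succ n ih =>
      obtain ⟨V, hx, s, hs⟩ := ih fun l => e l.succ
      obtain ⟨W, hxW, t, ht⟩ := M.presheaf.exists_germ_eq (e 0)
      refine ⟨V ⊓ W, ⟨hx, hxW⟩, Fin.cons (M.presheaf.map (Opens.infLERight V W).op t)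
        fun l => M.presheaf.map (Opens.infLELeft V W).op (s l), fun l => ?_⟩
      refine Fin.cases ?_ (fun l => ?_) l
      · exact (M.presheaf.germ_res_apply (Opens.infLERight V W) x ⟨hx, hxW⟩ t).trans ht
      · exact (M.presheaf.germ_res_apply (Opens.infLELeft V W) x ⟨hx, hxW⟩ (s l)).trans (hs l)
  obtain ⟨V, hx, s, hs⟩ := key n e
  obtain ⟨W, hxW, j, hW⟩ := exists_res_eq_zero hx (∑ l, a l • s l) (by
    rw [map_sum, ← he]
    exact Finset.sum_congr rfl fun l _ => by rw [map_smul, hs])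
  obtain ⟨U, hU, hxU, hUW⟩ := Opens.isBasis_iff_nbhd.1 hB hxW
  have := h U hU
  -- A relation between germs already holds between sections over some basic open set; trivialize it
  -- there and take germs.
  obtain ⟨k, c, y, hy, hc⟩ := Module.Flat.iff_forall_isTrivialRelation.1 this
    (f := a) (x := fun l => M.presheaf.map (homOfLE hUW ≫ j).op (s l)) (by
      have h0 : M.presheaf.map (homOfLE hUW ≫ j).op (∑ l, a l • s l) = 0 := by
        rw [op_comp, Functor.map_comp]
        exact (congrArg (M.presheaf.map (homOfLE hUW).op) hW).trans (map_zero _)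
      rw [← h0, map_sum]
      exact Finset.sum_congr rfl fun l _ => (map_smul _ _ _).symm)
  refine ⟨k, c, fun j => M.presheaf.germ U x hxU (y j), fun l => ?_, hc⟩
  rw [← hs l, ← M.presheaf.germ_res_apply (homOfLE hUW ≫ j) x hxU (s l)]
  refine (congrArg (M.presheaf.germ U x hxU) (hy l)).trans ?_
  rw [map_sum]
  exact Finset.sum_congr rfl fun j _ => map_smul _ _ _

namespace AdicSystem

/-! ### Completeness from the reductions -/

section Completion

variable {A : Type u} [CommRing A] {X : TopCat.{u}} {𝔪 : Ideal A} (S : AdicSystem X 𝔪)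

lemma toTensor_inducedHom (i : ℕ) :
    toTensor 𝔪 i S.lim ≫ inducedHom (S.killed i) (S.proj i) = S.proj i := by
  apply Sheaf.hom_ext
  refine (Category.assoc _ _ _).trans ?_
  refine (congrArg (toTensorPresheaf 𝔪 i S.lim.presheaf ≫ ·)
    (toSheafify_inducedHom (S.killed i) (S.proj i))).trans ?_
  ext U s
  exact inducedPresheafHom_app_one_tmul (S.killed i) (S.proj i) U s

lemma tensorSheafMap_inducedHom (i : ℕ) :
    tensorSheafMap (quotMap 𝔪 i) S.lim ≫ inducedHom (S.killed i) (S.proj i) =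
      inducedHom (S.killed (i + 1)) (S.proj (i + 1)) ≫ S.ψ i := by
  apply Sheaf.hom_ext
  refine sheafify_hom_ext (Opens.grothendieckTopology X) _ _ (S.obj i).property ?_
  refine (Category.assoc _ _ _).symm.trans ?_
  refine (congrArg (· ≫ (inducedHom (S.killed i) (S.proj i)).hom)
    (toSheafify_naturality (Opens.grothendieckTopology X) _).symm).trans ?_
  refine (Category.assoc _ _ _).trans ?_
  refine (congrArg (_ ≫ ·) (toSheafify_inducedHom (S.killed i) (S.proj i))).trans ?_
  refine Eq.trans ?_ (Category.assoc _ _ _)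
  refine Eq.trans ?_ (congrArg (· ≫ (S.ψ i).hom)
    (toSheafify_inducedHom (S.killed (i + 1)) (S.proj (i + 1)))).symm
  ext U w
  obtain ⟨s, rfl⟩ := exists_eq_one_tmul (I := 𝔪 ^ (i + 1 + 1)) (N := S.lim.presheaf.obj U) w
  have h1 := inducedPresheafHom_app_one_tmul (S.killed i) (S.proj i) U.unop s
  have h2 := inducedPresheafHom_app_one_tmul (S.killed (i + 1)) (S.proj (i + 1)) U.unop s
  have h3 := congrArg (fun f : S.lim ⟶ S.obj i => f.hom.app U s) (S.proj_ψ i)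
  have h4 : quotMap 𝔪 i 1 = 1 := map_one (Ideal.Quotient.factorₐ A
    (Ideal.pow_le_pow_right (Nat.le_succ (i + 1))))
  refine (congrArg (fun a => (inducedPresheafHom (S.killed i) (S.proj i)).app U
    (a ⊗ₜ[A] s)) h4).trans ?_
  refine h1.trans (h3.symm.trans ?_)
  exact congrArg ((S.ψ i).hom.app U) h2.symm

/-- The isomorphisms `A_i ⊗ M → M_i` are compatible, so their limit is an isomorphism. Its composite
with the canonical map from `M` is the identity, so that map is its inverse. -/
lemma isAdicallyComplete_lim
    (h : ∀ i, IsIso (inducedHom (S.killed i) (S.proj i))) : IsAdicallyComplete 𝔪 S.lim := by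
  let e : completionSystem 𝔪 S.lim ⟶ Functor.ofOpSequence S.ψ :=
    NatTrans.ofOpSequence (fun i => inducedHom (S.killed i) (S.proj i)) fun i => by
      have h₁ : (completionSystem 𝔪 S.lim).map (homOfLE (i.le_add_right 1)).op =
          tensorSheafMap (quotMap 𝔪 i) S.lim :=
        Functor.ofOpSequence_map_homOfLE_succ (X := fun i => tensorSheaf (QuotPow 𝔪 i) S.lim)
          (fun i => tensorSheafMap (quotMap 𝔪 i) S.lim) i
      have h₂ := Functor.ofOpSequence_map_homOfLE_succ S.ψ i
      refine (congrArg (· ≫ inducedHom (S.killed i) (S.proj i)) h₁).trans ?_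
      refine (S.tensorSheafMap_inducedHom i).trans ?_
      exact congrArg (inducedHom (S.killed (i + 1)) (S.proj (i + 1)) ≫ ·) h₂.symm
  have he : IsIso e := by
    have (j : ℕᵒᵖ) : IsIso (e.app j) := h j.unop
    exact NatIso.isIso_of_isIso_app e
  have hlim : IsIso (limMap e) := inferInstance
  have hcomp : toCompletion 𝔪 S.lim ≫ limMap e = 𝟙 S.lim := by
    refine limit.hom_ext fun j => ?_
    rw [Category.assoc, limMap_π, Category.id_comp, toCompletion, limit.lift_π_assoc]
    exact S.toTensor_inducedHom j.unop
  have : toCompletion 𝔪 S.lim = inv (limMap e) := by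
    rw [← cancel_mono (limMap e), hcomp, IsIso.inv_hom_id]
  rw [IsAdicallyComplete, this]
  infer_instance

end Completion

variable {A : Type u} [CommRing A] [IsLocalRing A] [IsNoetherianRing A] {X : TopCat.{u}}
  {𝔪 : Ideal A} [IsAdicComplete 𝔪 A] (S : AdicSystem X 𝔪)

/-- By the stalk criterion, surjectivity and the kernel have to be checked on germs. After shrinking
to a simply connected neighbourhood, both follow from the tower of sections there. -/
lemma isIso_inducedHom_proj (h𝔪 : 𝔪 = IsLocalRing.maximalIdeal A)
    (hflat : ∀ i, IsFlatOverQuotient (S.killed i))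
    (hX : IsLocallySimplyConnected (toAb (S.obj 0))) (i : ℕ) :
    IsIso (inducedHom (S.killed i) (S.proj i)) := by
  have hmax : 𝔪.IsMaximal := h𝔪 ▸ inferInstance
  rw [isIso_inducedHom_iff]
  refine fun x => ⟨fun e => ?_, fun e he => ?_⟩
  · obtain ⟨U, hx, s, rfl⟩ := (S.obj i).presheaf.exists_germ_eq e
    obtain ⟨V, hV, hxV, hVU⟩ := Opens.isBasis_iff_nbhd.1 hX hx
    obtain ⟨t, ht⟩ := (S.isTowerLimit_sections V).proj_surjective
      (S.isFreeTower_sections h𝔪 hflat V hV) i ((S.obj i).presheaf.map (homOfLE hVU).op s)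
    refine ⟨S.lim.presheaf.germ V x hxV t, ?_⟩
    rw [stalkMap_germ, ← (S.obj i).presheaf.germ_res_apply (homOfLE hVU) x hxV s]
    exact congrArg _ ht
  · obtain ⟨U, hx, s, rfl⟩ := S.lim.presheaf.exists_germ_eq e
    rw [stalkMap_germ] at he
    obtain ⟨W, hxW, j, hW⟩ := exists_res_eq_zero hx _ he
    obtain ⟨V, hV, hxV, hVW⟩ := Opens.isBasis_iff_nbhd.1 hX hxW
    have hs : S.sectionsProj V i (S.lim.presheaf.map (homOfLE hVW ≫ j).op s) = 0 := by
      refine (ConcreteCategory.congr_hom ((S.proj i).hom.naturality (homOfLE hVW ≫ j).op)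
        s).trans ?_
      rw [op_comp, Functor.map_comp]
      exact (congrArg ((S.obj i).presheaf.map (homOfLE hVW).op) hW).trans (map_zero _)
    have h := (S.isTowerLimit_sections V).mem_smul_top_of_proj_eq_zero hmax
      (S.isFreeTower_sections h𝔪 hflat V hV) i _ hs
    have := Submodule.mem_map_of_mem (f := (S.lim.presheaf.germ V x hxV).hom) h
    rw [Submodule.map_smul''] at this
    rw [← S.lim.presheaf.germ_res_apply (homOfLE hVW ≫ j) x hxV s]
    exact Submodule.smul_mono le_rfl le_top this

end AdicSystem

end AdicSheaf

theorem corollary5p7 {A : Type u} [CommRing A] [IsLocalRing A] [IsNoetherianRing A]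
    [IsAdicComplete (IsLocalRing.maximalIdeal A) A] (X : TopCat.{u})
    (S : AdicSheaf.AdicSystem X (IsLocalRing.maximalIdeal A))
    (hflat : ∀ i, AdicSheaf.IsFlatOverQuotient (S.killed i))
    (hX : AdicSheaf.IsLocallySimplyConnected (AdicSheaf.toAb (S.obj 0))) :
    (AdicSheaf.IsFlat S.lim ∧
      AdicSheaf.IsAdicallyComplete (IsLocalRing.maximalIdeal A) S.lim) ∧
    (∀ i, IsIso (AdicSheaf.inducedHom (S.killed i) (S.proj i))) ∧
    (∀ U : Opens X, AdicSheaf.IsSimplyConnected (AdicSheaf.toAb (S.obj 0)) U →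
      AdicSheaf.IsAdicallyFree (IsLocalRing.maximalIdeal A)
        (S.lim.presheaf.obj (op U))) := by
  have hiso := S.isIso_inducedHom_proj rfl hflat hX
  have htower (U : Opens X) (hU : AdicSheaf.IsSimplyConnected (AdicSheaf.toAb (S.obj 0)) U) :=
    S.isFreeTower_sections rfl hflat U hU
  refine ⟨⟨AdicSheaf.isFlat_of_isBasis S.lim hX fun U hU => ?_, S.isAdicallyComplete_lim hiso⟩,
    hiso, fun U hU => ?_⟩
  · exact (S.isTowerLimit_sections U).flat inferInstance (htower U hU)
  · exact (S.isTowerLimit_sections U).isAdicallyFree inferInstance (htower U hU)
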